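/- Theorem. Consider the planar Newtonian $4$-body problem with masses $m_1=m_2=1$ and $m_3=m_4=m$. A central configuration is a configuration $q_1,\dots,q_4\in\mathbb R^2$ for which there is a constant $\lambda\in\mathbb R$ with $$\lambda\,(q_j-c)=\sum_{i\ne j}\frac{m_i\,(q_j-q_i)}{|q_j-q_i|^3}\qquad (j=1,\dots,4),$$ where $c=\frac{1}{\sum_i m_i}\sum_i m_iq_i$ is the center of mass. For $m>0$ the $q_i$ are required to be pairwise distinct; for $m=0$ the massless bodies $3$ and $4$ exert no force (their terms are omitted), the four equations are still required, and only $q_3$ and $q_4$ are allowed to coincide. Call a central configuration a concave kite (with base $q_1q_2$) if it is not collinear, $q_3$ and $q_4$ lie on the perpendicular bisector of $q_1q_2$, and some body lies in the (closed) convex hull of the other three. Two configurations are of the same type if one is obtained from the other by a translation, a dilation and a rotation, where the bodies within each of the pairs $\{1,2\}$ and $\{3,4\}$ may be interchanged. There is a number $m_0$, $m_0\approx 1.002713329037083$ (with error at most $5\cdot10^{-16}$), such that 1. for $0<m<m_0$ there are exactly two types of concave kite central configurations; 2. for $m=m_0$ there is exactly one type; 3. for $m>m_0$ there is no concave kite central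 configuration. For $m=0$ there are exactly two types. More precisely, if the bodies are labelled so that $q_3$ lies in the convex hull of $q_1,q_2,q_4$, then a configuration is a concave kite central configuration for $m=0$ if and only if $q_1,q_2,q_4$ form a non-degenerate equilateral triangle and $q_3$ is either the midpoint of $q_1q_2$ or coincides with $q_4$. -/

import Mathlib

/-- The centre of mass `(∑ μᵢ qᵢ) / (∑ μᵢ)` of planar bodies `q i` with masses `μ i`.
The Euclidean plane is `ℂ`. -/
noncomputable def centerOfMass {n : ℕ} (μ : Fin n → ℝ) (q : Fin n → ℂ) : ℂ :=
  (∑ i, μ i)⁻¹ • ∑ i, μ i • q i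

/-- Planar Newtonian central configurations:
`lam (q_j - c) = ∑_{i ≠ j} m_i (q_j - q_i) / |q_j - q_i|³` for every body `j`.
For positive masses this is the usual equation
`-lam m_j (q_j - c) = ∑_{i ≠ j} m_i m_j (q_i - q_j) / r_ij³`, divided by `-m_j`, for
collision-free `q`.  Bodies of mass zero exert no force (so they contribute no term), but the
equation has to hold for them as well; two bodies may coincide only if both are massless. -/
def IsCentralConfiguration {n : ℕ} (μ : Fin n → ℝ) (q : Fin n → ℂ) : Prop :=
  (∀ i j, i ≠ j → (μ i ≠ 0 ∨ μ j ≠ 0) → q i ≠ q j) ∧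
  ∃ lam : ℝ, ∀ j, lam • (q j - centerOfMass μ q) =
    ∑ i with i ≠ j ∧ μ i ≠ 0, (μ i / dist (q i) (q j) ^ 3) • (q j - q i)

/-- The masses `m₁ = m₂ = 1`, `m₃ = m₄ = m` (bodies `1, 2, 3, 4` have indices `0, 1, 2, 3`). -/
def pairMass (m : ℝ) : Fin 4 → ℝ := ![1, 1, m, m]

/-- A kite with base `q₁q₂`: not collinear, with `q₃`, `q₄` on the axis of symmetry, i.e. on the
perpendicular bisector of `q₁q₂`. -/
def IsKite (q : Fin 4 → ℂ) : Prop :=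
  ¬ Collinear ℝ (Set.range q) ∧ q 0 ≠ q 1 ∧
  q 2 ∈ AffineSubspace.perpBisector (q 0) (q 1) ∧
  q 3 ∈ AffineSubspace.perpBisector (q 0) (q 1)

/-- Concave: some body lies in the convex hull of the other three. -/
def IsConcave (q : Fin 4 → ℂ) : Prop :=
  ∃ i, q i ∈ convexHull ℝ (q '' {j | j ≠ i})

/-- Concave kite central configurations with `m₁ = m₂ = 1` on the base and `m₃ = m₄ = m` on the
symmetry axis. -/
def IsConcaveKiteCC (m : ℝ) (q : Fin 4 → ℂ) : Prop :=
  IsCentralConfiguration (pairMass m) q ∧ IsKite q ∧ IsConcave q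

/-- Two configurations are of the same type if one is carried to the other by a translation, a
dilation and a rotation, `z ↦ w z + v` with `w ≠ 0`, the two bodies within each of the pairs
`{1, 2}` and `{3, 4}` of equal masses being interchangeable. -/
def configSetoid : Setoid (Fin 4 → ℂ) where
  r q q' := ∃ σ : Equiv.Perm (Fin 4),
      (∀ i, σ i ∈ ({0, 1} : Set (Fin 4)) ↔ i ∈ ({0, 1} : Set (Fin 4))) ∧
    ∃ w v : ℂ, w ≠ 0 ∧ ∀ i, q' i = w * q (σ i) + v
  iseqv :=
    { refl := fun q => ⟨1, fun _ => Iff.rfl, 1, 0, one_ne_zero, fun i => by simp⟩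
      symm := by
        rintro q q' ⟨σ, hσ, w, v, hw, h⟩
        refine ⟨σ.symm, fun i => ?_, w⁻¹, -(w⁻¹ * v), inv_ne_zero hw, fun i => ?_⟩
        · rw [← hσ (σ.symm i), Equiv.apply_symm_apply]
        · rw [h, Equiv.apply_symm_apply]
          field_simp
          ring
      trans := by
        rintro q q' q'' ⟨σ, hσ, w, v, hw, h⟩ ⟨τ, hτ, w', v', hw', h'⟩
        refine ⟨σ * τ, fun i => ?_, w' * w, w' * v + v', mul_ne_zero hw' hw, fun i => ?_⟩
        · rw [Equiv.Perm.mul_apply, hσ, hτ]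
        · rw [h', h, Equiv.Perm.mul_apply]
          ring }

/-- The set of types of concave kite central configurations for the mass parameter `m`. -/
def concaveKiteTypes (m : ℝ) : Set (Quotient configSetoid) :=
  Quotient.mk configSetoid '' {q | IsConcaveKiteCC m q}

/-! A similarity, together with swaps inside the two pairs, puts the base at -1, 1 and the other
bodies at x i and y i with 0 ≤ x ≤ y; the pair (x, y) is then determined by the type
(`eq_of_standardKite_equiv`). Let p, q be the reciprocal distances of x i, y i from the base points,
d = y - x, a = 8p³ - 1, b = 8q³ - 1, u = 1 - d³p³, v = 1 - d³q³. For m > 0 and x < y the equations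
reduce to 4mv = x a d² and 4mu = -y b d² (`kiteEquations_iff`). As v > 0, they say that (x, y) lies
on the curve x a u + y b v = 0 with 0 < x < √3, and that m = x a d² / (4v).

The y-derivative of the curve's equation is negative on the curve, so the curve is a graph y =
`kiteHeight x` over (0, √3) and the mass is a function `kiteMass` of x alone; counting types means
counting its fibres. It tends to 0 at both ends (`kiteMass_le`), and its derivative has the sign
opposite to `massSlope`. Along the curve `massSlope` is negative for x ≤ 39/64, positive for x ≥ 5/8
and strictly increasing in between. Hence `kiteMass` rises to a single maximum m₀ and then falls:
two preimages below m₀, one at m₀, none above.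

The signs are certified by interval arithmetic in the kernel: `zeroSetCheck` bisects a box, discards
the pieces that miss the curve and tests the others (`zeroSetCheck_sound`). The curve stays in 1 ≤ y
≤ 4, so compact boxes suffice. Enclosing the critical x in an interval of length 2^(-64) gives the
digits of m₀.

For m = 0 the equations of the two massless bodies decouple, and each height t satisfies t = 0 or t²
= 3. -/

/-! ### Symbolic expressions and their formal derivatives -/

/-- Polynomial expressions in `x`, `p = (1 + x²)^(-1/2)`, `y`, `q = (1 + y²)^(-1/2)`. -/
inductive KiteExpr where
  | const (n : ℤ)
  | x
  | p
  | y
  | q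
  | add (e f : KiteExpr)
  | sub (e f : KiteExpr)
  | mul (e f : KiteExpr)
  | pow (e : KiteExpr) (n : ℕ)

/-- The reciprocal of the distance from `x i` to `1` in the complex plane. -/
noncomputable def invDist (x : ℝ) : ℝ := (√(1 + x ^ 2))⁻¹

namespace KiteExpr

/-- The value of an expression at real values of its four variables. -/
def val (x p y q : ℝ) : KiteExpr → ℝ
  | const n => n
  | .x => x
  | .p => p
  | .y => y
  | .q => q
  | add e f => e.val x p y q + f.val x p y q
  | sub e f => e.val x p y q - f.val x p y q
  | mul e f => e.val x p y q * f.val x p y q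
  | pow e n => e.val x p y q ^ n

/-- The value of an expression as a function of `x` and `y`. -/
noncomputable def eval (e : KiteExpr) (x y : ℝ) : ℝ := e.val x (invDist x) y (invDist y)

/-- Partial derivative with respect to `x`. -/
def dx : KiteExpr → KiteExpr
  | const _ => const 0
  | .x => const 1
  | .p => sub (const 0) (mul .x (pow .p 3))
  | .y => const 0
  | .q => const 0
  | add e f => add e.dx f.dx
  | sub e f => sub e.dx f.dx
  | mul e f => add (mul e.dx f) (mul e f.dx)
  | pow e n => mul (mul (const n) (pow e (n - 1))) e.dx

/-- Partial derivative with respect to `y`. -/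
def dy : KiteExpr → KiteExpr
  | const _ => const 0
  | .x => const 0
  | .p => const 0
  | .y => const 1
  | .q => sub (const 0) (mul .y (pow .q 3))
  | add e f => add e.dy f.dy
  | sub e f => sub e.dy f.dy
  | mul e f => add (mul e.dy f) (mul e f.dy)
  | pow e n => mul (mul (const n) (pow e (n - 1))) e.dy

end KiteExpr

/-! ### Smoothness, chain rule and implicit functions -/

theorem invDist_pos (x : ℝ) : 0 < invDist x := by
  unfold invDist; positivity

theorem invDist_sq (x : ℝ) : invDist x ^ 2 * (1 + x ^ 2) = 1 := by
  unfold invDist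
  rw [inv_pow, Real.sq_sqrt (by positivity)]
  exact inv_mul_cancel₀ (by positivity)

theorem hasDerivAt_invDist (x : ℝ) : HasDerivAt invDist (-(x * invDist x ^ 3)) x := by
  have h1 : HasDerivAt (fun x : ℝ => 1 + x ^ 2) (2 * x) x := by
    simpa using (hasDerivAt_pow 2 x).const_add 1
  have h0 : (0 : ℝ) < 1 + x ^ 2 := by positivity
  have h2 := (h1.sqrt h0.ne').inv (by positivity)
  refine h2.congr_deriv ?_
  unfold invDist
  field_simp

theorem contDiff_invDist {n : WithTop ℕ∞} : ContDiff ℝ n invDist := by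
  unfold invDist
  refine ContDiff.inv ?_ (fun x => by positivity)
  exact ContDiff.sqrt (by fun_prop) (fun x => by positivity)

theorem KiteExpr.contDiff_eval (e : KiteExpr) {n : WithTop ℕ∞} :
    ContDiff ℝ n (fun z : ℝ × ℝ => e.eval z.1 z.2) := by
  unfold eval
  induction e with
  | const n => simp only [val]; fun_prop
  | x => simp only [val]; fun_prop
  | y => simp only [val]; fun_prop
  | p => exact contDiff_invDist.comp contDiff_fst
  | q => exact contDiff_invDist.comp contDiff_snd
  | add e f he hf => exact he.add hf
  | sub e f he hf => exact he.sub hf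
  | mul e f he hf => exact he.mul hf
  | pow e n he => exact he.pow n

/-- The chain rule along a curve in the plane. -/
theorem KiteExpr.hasDerivAt_eval (e : KiteExpr) {X Y : ℝ → ℝ} {X' Y' t : ℝ}
    (hX : HasDerivAt X X' t) (hY : HasDerivAt Y Y' t) :
    HasDerivAt (fun s => e.eval (X s) (Y s))
      (e.dx.eval (X t) (Y t) * X' + e.dy.eval (X t) (Y t) * Y') t := by
  unfold eval
  induction e with
  | const n => simpa [val, dx, dy] using hasDerivAt_const t (n : ℝ)
  | x => simpa [val, dx, dy] using hX
  | y => simpa [val, dx, dy] using hY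
  | p =>
    refine ((hasDerivAt_invDist (X t)).comp t hX).congr_deriv ?_
    simp [val, dx, dy]
  | q =>
    refine ((hasDerivAt_invDist (Y t)).comp t hY).congr_deriv ?_
    simp [val, dx, dy]
  | add e f he hf =>
    refine (he.add hf).congr_deriv ?_
    simp only [val, dx, dy]; ring
  | sub e f he hf =>
    refine (he.sub hf).congr_deriv ?_
    simp only [val, dx, dy]; ring
  | mul e f he hf =>
    refine (he.mul hf).congr_deriv ?_
    simp only [val, dx, dy]; ring
  | pow e n he =>
    refine (he.pow n).congr_deriv ?_
    simp only [val, dx, dy]; push_cast; ring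

/-- The implicit function theorem for a zero at which the partial derivative with respect to `y`
does not vanish. -/
theorem KiteExpr.exists_implicit (e : KiteExpr) {x₀ y₀ : ℝ} (h0 : e.eval x₀ y₀ = 0)
    (hy : e.dy.eval x₀ y₀ ≠ 0) :
    ∃ ψ : ℝ → ℝ, ψ x₀ = y₀ ∧
      HasDerivAt ψ (-(e.dx.eval x₀ y₀ / e.dy.eval x₀ y₀)) x₀ ∧
      ∀ᶠ x in nhds x₀, e.eval x (ψ x) = 0 := by
  have hs : HasStrictFDerivAt (fun z : ℝ × ℝ => e.eval z.1 z.2)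
      (fderiv ℝ (fun z : ℝ × ℝ => e.eval z.1 z.2) (x₀, y₀)) (x₀, y₀) :=
    (e.contDiff_eval (n := 1)).contDiffAt.hasStrictFDerivAt one_ne_zero
  set f' := fderiv ℝ (fun z : ℝ × ℝ => e.eval z.1 z.2) (x₀, y₀) with hf'
  have hpart : (f' ∘L .inr ℝ ℝ ℝ) 1 = e.dy.eval x₀ y₀ := by
    have h1 := e.hasDerivAt_eval (hasDerivAt_const y₀ x₀) (hasDerivAt_id y₀)
    have h2 : HasDerivAt (fun s : ℝ => ((x₀, s) : ℝ × ℝ)) (0, 1) y₀ :=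
      (hasDerivAt_const y₀ x₀).prodMk (hasDerivAt_id y₀)
    have h3 := HasFDerivAt.comp_hasDerivAt (f := fun s : ℝ => ((x₀, s) : ℝ × ℝ)) y₀
      hs.hasFDerivAt h2
    have h4 := h1.unique h3
    simp only [mul_zero, zero_add, mul_one, id] at h4
    simp [h4]
  have hinv : (f' ∘L .inr ℝ ℝ ℝ).IsInvertible := by
    refine ⟨ContinuousLinearEquiv.unitsEquivAut ℝ (Units.mk0 _ hy), ?_⟩
    ext
    simp only [ContinuousLinearEquiv.coe_coe, ContinuousLinearEquiv.unitsEquivAut_apply, one_mul,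
      Units.val_mk0, hpart]
  set ψ := hs.implicitFunctionOfProdDomain hinv with hψ
  have hval : ψ x₀ = y₀ :=
    (hs.eventually_apply_eq_iff_implicitFunctionOfProdDomain hinv).self_of_nhds.mp rfl
  have hev : ∀ᶠ x in nhds x₀, e.eval x (ψ x) = 0 := by
    filter_upwards [hs.eventually_apply_implicitFunctionOfProdDomain hinv] with x hx
    rw [← h0]; exact hx
  have hd : HasDerivAt ψ (deriv ψ x₀) x₀ :=
    (hs.hasStrictFDerivAt_implicitFunctionOfProdDomain hinv).hasFDerivAt.differentiableAt.hasDerivAt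
  refine ⟨ψ, hval, ?_, hev⟩
  -- The slope of `ψ` comes from differentiating the identity e(x, ψ x) = 0.
  have h1 := e.hasDerivAt_eval (hasDerivAt_id x₀) hd
  have h2 : HasDerivAt (fun s => e.eval (id s) (ψ s)) 0 x₀ :=
    (hasDerivAt_const x₀ (0 : ℝ)).congr_of_eventuallyEq hev
  have h3 := h1.unique h2
  simp only [id, hval, mul_one] at h3
  convert hd using 1
  field_simp
  linarith

/-! ### Interval arithmetic with integer endpoints -/

/-- An interval with endpoints in `S⁻¹ ℤ`, where the scale `S` is kept separately. -/
structure ScaledInterval where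
  lo : ℤ
  hi : ℤ

namespace ScaledInterval

/-- The real number `v` lies in the interval `I` of scale `S`. -/
def Has (S : ℕ) (I : ScaledInterval) (v : ℝ) : Prop := (I.lo : ℝ) ≤ v * S ∧ v * S ≤ I.hi

def add : ScaledInterval → ScaledInterval → ScaledInterval
  | ⟨a, b⟩, ⟨c, d⟩ => ⟨a + c, b + d⟩

def sub : ScaledInterval → ScaledInterval → ScaledInterval
  | ⟨a, b⟩, ⟨c, d⟩ => ⟨a - d, b - c⟩

/-- Outward rounding of the interval with endpoints `a / S ^ 2`, `b / S ^ 2`. -/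
def round (S : ℕ) (a b : ℤ) : ScaledInterval := ⟨a / S, b / S + 1⟩

def mul (S : ℕ) : ScaledInterval → ScaledInterval → ScaledInterval
  | ⟨a, b⟩, ⟨c, d⟩ =>
    match a, c with
    -- Fast path: with both lower endpoints nonnegative, the extreme products are known in advance.
    | .ofNat m, .ofNat n => round S (m * n : ℕ) (b * d)
    | _, _ =>
      round S (min (min (a * c) (a * d)) (min (b * c) (b * d)))
        (max (max (a * c) (a * d)) (max (b * c) (b * d)))

def pow (S : ℕ) (I : ScaledInterval) : ℕ → ScaledInterval
  | 0 => ⟨S, S⟩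
  | 1 => I
  | n + 2 => mul S (pow S I (n + 1)) I

variable {S : ℕ} {I J : ScaledInterval} {u v : ℝ}

theorem Has.add (hu : Has S I u) (hv : Has S J v) : Has S (I.add J) (u + v) := by
  obtain ⟨a, b⟩ := I
  obtain ⟨c, d⟩ := J
  simp only [Has, ScaledInterval.add] at *
  push_cast
  constructor <;> linarith

theorem Has.sub (hu : Has S I u) (hv : Has S J v) : Has S (I.sub J) (u - v) := by
  obtain ⟨a, b⟩ := I
  obtain ⟨c, d⟩ := J
  simp only [Has, ScaledInterval.sub] at *
  push_cast
  constructor <;> linarith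

theorem has_round (hS : 0 < S) {a b : ℤ} (ha : (a : ℝ) ≤ v * S * S) (hb : v * S * S ≤ b) :
    Has S (round S a b) v := by
  have hS' : (0 : ℝ) < S := by exact_mod_cast hS
  have hZ : (0 : ℤ) < S := by exact_mod_cast hS
  constructor
  · have h1 : ((a / S * S : ℤ) : ℝ) ≤ a := by exact_mod_cast Int.ediv_mul_le a hZ.ne'
    push_cast at h1
    exact le_of_mul_le_mul_right (by simpa [round] using h1.trans ha) hS'
  · have h1 : (b : ℝ) < ((b / S + 1) * S : ℤ) := by
      exact_mod_cast Int.lt_ediv_add_one_mul_self b hZ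
    push_cast at h1
    exact le_of_mul_le_mul_right (by simpa [round] using hb.trans h1.le) hS'

/-- A bilinear function on a rectangle takes its extreme values at corners. -/
theorem min_le_mul_le_max {a b c d u v : ℝ} (h1 : a ≤ u) (h2 : u ≤ b) (h3 : c ≤ v) (h4 : v ≤ d) :
    min (min (a * c) (a * d)) (min (b * c) (b * d)) ≤ u * v ∧
      u * v ≤ max (max (a * c) (a * d)) (max (b * c) (b * d)) := by
  constructor
  · simp only [min_le_iff]
    rcases le_total 0 v with hv | hv
    · rcases le_total 0 a with ha | ha
      · exact .inl (.inl (by nlinarith))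
      · exact .inl (.inr (by nlinarith))
    · rcases le_total 0 b with hb | hb
      · exact .inr (.inl (by nlinarith))
      · exact .inr (.inr (by nlinarith))
  · simp only [le_max_iff]
    rcases le_total 0 v with hv | hv
    · rcases le_total 0 b with hb | hb
      · exact .inr (.inr (by nlinarith))
      · exact .inr (.inl (by nlinarith))
    · rcases le_total 0 a with ha | ha
      · exact .inl (.inr (by nlinarith))
      · exact .inl (.inl (by nlinarith))

theorem Has.mul (hS : 0 < S) (hu : Has S I u) (hv : Has S J v) : Has S (mul S I J) (u * v) := by
  obtain ⟨a, b⟩ := I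
  obtain ⟨c, d⟩ := J
  have h := min_le_mul_le_max hu.1 hu.2 hv.1 hv.2
  have e : u * v * S * S = u * S * (v * S) := by ring
  unfold ScaledInterval.mul
  simp only
  split
  · next m n =>
    have hm : (m : ℝ) ≤ u * S := by simpa using hu.1
    have hn : (n : ℝ) ≤ v * S := by simpa using hv.1
    have hm0 : (0 : ℝ) ≤ m := m.cast_nonneg
    have hn0 : (0 : ℝ) ≤ n := n.cast_nonneg
    apply has_round hS
    · push_cast; rw [e]; exact mul_le_mul hm hn hn0 (hm0.trans hm)
    · push_cast; rw [e]; exact mul_le_mul hu.2 hv.2 (hn0.trans hn) ((hm0.trans hm).trans hu.2)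
  · apply has_round hS
    · push_cast; rw [e]; exact h.1
    · push_cast; rw [e]; exact h.2

theorem Has.pow (hS : 0 < S) (hu : Has S I u) (n : ℕ) : Has S (pow S I n) (u ^ n) := by
  induction n using Nat.twoStepInduction with
  | zero => simp [Has, ScaledInterval.pow]
  | one => simpa [ScaledInterval.pow] using hu
  | more n _ h => rw [pow_succ]; exact h.mul hS hu

/-- The interval is contained in the negative half-line. -/
def isNeg (I : ScaledInterval) : Bool := decide (I.hi < 0)

/-- The interval is contained in the positive half-line. -/
def isPos (I : ScaledInterval) : Bool := decide (0 < I.lo)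

theorem Has.neg_of_isNeg (h : Has S I v) (hI : I.isNeg = true) : v < 0 := by
  have h1 : (I.hi : ℝ) < 0 := by exact_mod_cast of_decide_eq_true hI
  have h2 : (0 : ℝ) ≤ S := S.cast_nonneg
  by_contra hv
  nlinarith [h.2]

theorem Has.pos_of_isPos (h : Has S I v) (hI : I.isPos = true) : 0 < v := by
  have h1 : (0 : ℝ) < I.lo := by exact_mod_cast of_decide_eq_true hI
  have h2 : (0 : ℝ) ≤ S := S.cast_nonneg
  by_contra hv
  nlinarith [h.1]

end ScaledInterval

open ScaledInterval in
/-- Interval evaluation of an expression. -/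
def KiteExpr.ieval (S : ℕ) (X P Y Q : ScaledInterval) : KiteExpr → ScaledInterval
  | const n => ⟨n * S, n * S⟩
  | .x => X
  | .p => P
  | .y => Y
  | .q => Q
  | add e f => (e.ieval S X P Y Q).add (f.ieval S X P Y Q)
  | sub e f => (e.ieval S X P Y Q).sub (f.ieval S X P Y Q)
  | mul e f => ScaledInterval.mul S (e.ieval S X P Y Q) (f.ieval S X P Y Q)
  | pow e n => ScaledInterval.pow S (e.ieval S X P Y Q) n

open ScaledInterval in
theorem KiteExpr.has_ieval {S : ℕ} (hS : 0 < S) {X P Y Q : ScaledInterval} {x p y q : ℝ}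
    (hx : Has S X x) (hp : Has S P p) (hy : Has S Y y) (hq : Has S Q q) (e : KiteExpr) :
    Has S (e.ieval S X P Y Q) (e.val x p y q) := by
  induction e with
  | const n => simp [Has, ieval, val]
  | x => exact hx
  | p => exact hp
  | y => exact hy
  | q => exact hq
  | add e f he hf => exact he.add hf
  | sub e f he hf => exact he.sub hf
  | mul e f he hf => exact he.mul hS hf
  | pow e n he => exact he.pow hS n

/-- Newton's iteration for the integer square root, from above. -/
def newtonSqrt (n : ℕ) : ℕ → ℕ → ℕ
  | 0, g => g
  | k + 1, g => if (g + n / g) / 2 < g then newtonSqrt n k ((g + n / g) / 2) else g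

/-- A lower bound for `S * invDist (b / S)`. -/
def invDistLower (S b : ℕ) : ℕ :=
  -- The start `S + b` is at least the root; the added 1 pushes the divisor above it, so that the
  -- quotient is too small.
  let c := S * S / (newtonSqrt (S * S + b * b) 20 (S + b) + 1)
  -- Nothing is proved about Newton's iteration: its result is accepted only after this test, with
  -- the trivial bound 0 as fallback. The upper bound below works alike, with fallback `S`, since
  -- `invDist` is at most 1.
  if c ^ 2 * (S * S + b * b) ≤ S ^ 4 then c else 0

/-- An upper bound for `S * invDist (a / S)`. -/
def invDistUpper (S a : ℕ) : ℕ :=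
  let c := S * S / newtonSqrt (S * S + a * a) 20 (S + a) + 1
  if S ^ 4 ≤ c ^ 2 * (S * S + a * a) then c else S

/-- Enclosure of `invDist` on the interval with endpoints `a / S`, `b / S`. -/
def invDistInterval (S a b : ℕ) : ScaledInterval := ⟨invDistLower S b, invDistUpper S a⟩

theorem invDist_mul_sq (S : ℕ) (x : ℝ) :
    (invDist x * S) ^ 2 * ((S : ℝ) * S + (x * S) * (x * S)) = (S : ℝ) ^ 4 := by
  linear_combination (S : ℝ) ^ 4 * invDist_sq x

theorem invDistLower_le {S b : ℕ} (hS : 0 < S) {x : ℝ} (hx : 0 ≤ x) (hb : x * S ≤ b) :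
    (invDistLower S b : ℝ) ≤ invDist x * S := by
  have hS' : (0 : ℝ) < S := by exact_mod_cast hS
  have hp := invDist_pos x
  unfold invDistLower
  simp only
  split_ifs with h
  · set c := S * S / (newtonSqrt (S * S + b * b) 20 (S + b) + 1)
    have h1 : (c : ℝ) ^ 2 * (S * S + b * b) ≤ (S : ℝ) ^ 4 := by exact_mod_cast h
    have hm : (x * S) * (x * S) ≤ (b : ℝ) * b := mul_self_le_mul_self (by positivity) hb
    refine le_of_sq_le_sq ?_ (by positivity)
    refine le_of_mul_le_mul_right ?_ (show (0 : ℝ) < S * S + b * b by positivity)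
    refine h1.trans ?_
    rw [← invDist_mul_sq S x]
    gcongr
  · simpa using (mul_pos hp hS').le

theorem le_invDistUpper {S a : ℕ} (hS : 0 < S) {x : ℝ} (ha : (a : ℝ) ≤ x * S) :
    invDist x * S ≤ invDistUpper S a := by
  have hS' : (0 : ℝ) < S := by exact_mod_cast hS
  have hp := invDist_pos x
  unfold invDistUpper
  simp only
  split_ifs with h
  · set c := S * S / newtonSqrt (S * S + a * a) 20 (S + a) + 1
    have h1 : (S : ℝ) ^ 4 ≤ (c : ℝ) ^ 2 * (S * S + a * a) := by exact_mod_cast h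
    have hm : (a : ℝ) * a ≤ (x * S) * (x * S) := mul_self_le_mul_self (by positivity) ha
    refine le_of_sq_le_sq ?_ (by positivity)
    refine le_of_mul_le_mul_right ?_ (show (0 : ℝ) < S * S + a * a by positivity)
    refine le_trans ?_ h1
    rw [← invDist_mul_sq S x]
    gcongr
  · have h1 : invDist x ≤ 1 := by
      have := invDist_sq x
      nlinarith [mul_nonneg (sq_nonneg (invDist x)) (sq_nonneg x)]
    nlinarith

theorem has_invDistInterval {S a b : ℕ} (hS : 0 < S) {x : ℝ} (ha : (a : ℝ) ≤ x * S)
    (hb : x * S ≤ b) : (invDistInterval S a b).Has S (invDist x) := by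
  have hS' : (0 : ℝ) < S := by exact_mod_cast hS
  have hx : 0 ≤ x := by
    have : (0 : ℝ) ≤ a := a.cast_nonneg
    by_contra h
    nlinarith
  exact ⟨by simpa [invDistInterval] using invDistLower_le hS hx hb,
    by simpa [invDistInterval] using le_invDistUpper hS ha⟩

/-! ### Verified bisection on a zero set -/

/-- Adaptive bisection of the box `[xl, xh] × [yl, yh]` (in units of `S⁻¹`) into boxes that lie
below the diagonal, or on which `e` has no zero, or which pass `test`. -/
def zeroSetCheck (S : ℕ) (e : KiteExpr)
    (test : (KiteExpr → ScaledInterval) → Bool) : ℕ → ℕ → ℕ → ℕ → ℕ → Bool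
  | 0, _, _, _, _ => false
  | k + 1, xl, xh, yl, yh =>
    let ev := KiteExpr.ieval S ⟨xl, xh⟩ (invDistInterval S xl xh) ⟨yl, yh⟩
      (invDistInterval S yl yh)
    decide (yh < xl) || (ev e).isNeg || (ev e).isPos || test ev ||
    bif decide (yh - yl < xh - xl) then
      zeroSetCheck S e test k xl ((xl + xh) / 2) yl yh &&
        zeroSetCheck S e test k ((xl + xh) / 2) xh yl yh
    else
      zeroSetCheck S e test k xl xh yl ((yl + yh) / 2) &&
        zeroSetCheck S e test k xl xh ((yl + yh) / 2) yh

theorem zeroSetCheck_sound {S : ℕ} (hS : 0 < S) {e : KiteExpr}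
    {test : (KiteExpr → ScaledInterval) → Bool} {R : ℝ → ℝ → Prop}
    (htest : ∀ ev : KiteExpr → ScaledInterval, test ev = true → ∀ x y : ℝ,
      (∀ e' : KiteExpr, (ev e').Has S (e'.eval x y)) → R x y)
    {k xl xh yl yh : ℕ} (hc : zeroSetCheck S e test k xl xh yl yh = true) {x y : ℝ}
    (hx : (xl : ℝ) ≤ x * S ∧ x * S ≤ xh) (hy : (yl : ℝ) ≤ y * S ∧ y * S ≤ yh) (hxy : x ≤ y)
    (h0 : e.eval x y = 0) : R x y := by
  induction k generalizing xl xh yl yh with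
  | zero => simp [zeroSetCheck] at hc
  | succ k ih =>
    have hev : ∀ e' : KiteExpr, (e'.ieval S ⟨xl, xh⟩ (invDistInterval S xl xh) ⟨yl, yh⟩
        (invDistInterval S yl yh)).Has S (e'.eval x y) := fun e' =>
      KiteExpr.has_ieval hS (by simpa [ScaledInterval.Has] using hx)
        (has_invDistInterval hS hx.1 hx.2) (by simpa [ScaledInterval.Has] using hy)
        (has_invDistInterval hS hy.1 hy.2) e'
    rw [zeroSetCheck] at hc
    simp only [Bool.or_eq_true] at hc
    rcases hc with (((hc | hc) | hc) | hc) | hc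
    · have h1 : (yh : ℝ) < xl := by exact_mod_cast of_decide_eq_true hc
      have h2 : (0 : ℝ) ≤ S := S.cast_nonneg
      nlinarith [hx.1, hy.2]
    · exact absurd h0 ((hev e).neg_of_isNeg hc).ne
    · exact absurd h0 ((hev e).pos_of_isPos hc).ne'
    · exact htest _ hc x y hev
    · cases hd : decide (yh - yl < xh - xl) with
      | true =>
        rw [hd, cond_true, Bool.and_eq_true] at hc
        rcases le_total (x * S) (((xl + xh) / 2 : ℕ) : ℝ) with h | h
        · exact ih hc.1 ⟨hx.1, h⟩ hy
        · exact ih hc.2 ⟨h, hx.2⟩ hy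
      | false =>
        rw [hd, cond_false, Bool.and_eq_true] at hc
        rcases le_total (y * S) (((yl + yh) / 2 : ℕ) : ℝ) with h | h
        · exact ih hc.1 hx ⟨hy.1, h⟩
        · exact ih hc.2 hx ⟨h, hy.2⟩

/-! ### The equation of the curve and the slope of the mass -/

namespace KiteExpr

/-- The distance between bodies `3` and `4`. -/
def dd : KiteExpr := sub .y .x

/-- `aa` and `bb` compare the distances of bodies 3 and 4 from the base points with the base length
2; `uu` and `vv` compare them with the distance between bodies 3 and 4. -/
def aa : KiteExpr := sub (mul (const 8) (pow .p 3)) (const 1)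

def bb : KiteExpr := sub (mul (const 8) (pow .q 3)) (const 1)

def uu : KiteExpr := sub (const 1) (mul (pow dd 3) (pow .p 3))

def vv : KiteExpr := sub (const 1) (mul (pow dd 3) (pow .q 3))

/-- The curve of concave kite central configurations is the zero set of `ff`. -/
def ff : KiteExpr := add (mul .x (mul aa uu)) (mul .y (mul bb vv))

/-- `-∂a/∂x` with `a = 8 p ^ 3 - 1`, divided by `8`. -/
def xp5 : KiteExpr := mul (const 3) (mul .x (pow .p 5))

def yq5 : KiteExpr := mul (const 3) (mul .y (pow .q 5))

/-- A short form of `∂ff/∂x`. -/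
def ffx : KiteExpr :=
  add (add (mul (sub aa (mul (const 8) (mul .x xp5))) uu)
    (mul .x (mul aa (add (mul (const 3) (mul (pow dd 2) (pow .p 3))) (mul (pow dd 3) xp5)))))
    (mul (const 3) (mul .y (mul bb (mul (pow dd 2) (pow .q 3)))))

/-- A short form of `∂ff/∂y`. -/
def ffy : KiteExpr :=
  add (sub (mul (sub bb (mul (const 8) (mul .y yq5))) vv)
    (mul (const 3) (mul .x (mul aa (mul (pow dd 2) (pow .p 3))))))
    (mul .y (mul bb (sub (mul (pow dd 3) yq5) (mul (const 3) (mul (pow dd 2) (pow .q 3))))))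

/-- The product `3 x a d ^ 2 q ^ 3`. -/
def slopeTerm : KiteExpr := mul (const 3) (mul .x (mul aa (mul (pow dd 2) (pow .q 3))))

/-- The product `2 x v`. -/
def twoXV : KiteExpr := mul (const 2) (mul .x vv)

/-- The factor `1 - d y q ^ 2`. -/
def slopeFactor : KiteExpr := sub (const 1) (mul dd (mul .y (pow .q 2)))

/-- The product `v (a - 24 x ^ 2 p ^ 5)`. -/
def slopeMain : KiteExpr := mul vv (sub aa (mul (const 24) (mul (pow .x 2) (pow .p 5))))

/-- Up to a positive factor, minus the derivative of the mass along the curve `ff = 0`. -/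
def massSlope : KiteExpr :=
  sub (mul (sub (sub (mul dd slopeMain) (mul aa twoXV)) (mul dd slopeTerm)) ffy)
    (mul (add (mul aa twoXV) (mul dd (mul slopeTerm slopeFactor))) ffx)

/-- The coefficient of `dd` in `massSlope`. -/
def slope₁ : KiteExpr :=
  sub (mul (sub slopeMain slopeTerm) ffy) (mul (mul slopeTerm slopeFactor) ffx)

/-- The coefficient of `aa` in `massSlope`. -/
def slope₂ : KiteExpr := mul (const (-1)) (mul twoXV (add ffx ffy))

/-- Up to a negative factor, the derivative of `massSlope` along the curve `ff = 0`. -/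
def slopeBracket : KiteExpr := sub (mul massSlope.dx ffy) (mul massSlope.dy ffx)

/-- `4 m` is `massNum / vv`. -/
def massNum : KiteExpr := mul .x (mul aa (pow dd 2))

end KiteExpr

open KiteExpr

/-! ### Sign certificates by computation -/

/-- The box is [0, 7/4] × [1, 4]; 7/4 is a rational bound just above √3. The next checks cut the
x-range at 39/64, 5/8 and 1. -/
theorem check_ffy : zeroSetCheck (2 ^ 40) ff (fun ev => (ev ffy).isNeg) 30
    0 (7 * 2 ^ 38) (2 ^ 40) (4 * 2 ^ 40) = true := by decide +kernel

theorem check_massSlope_neg : zeroSetCheck (2 ^ 40) ff (fun ev => (ev massSlope).isNeg) 40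
    0 (39 * 2 ^ 34) (2 ^ 40) (4 * 2 ^ 40) = true := by decide +kernel

theorem check_massSlope_pos : zeroSetCheck (2 ^ 40) ff (fun ev => (ev massSlope).isPos) 40
    (5 * 2 ^ 37) (2 ^ 40) (2 ^ 40) (4 * 2 ^ 40) = true := by decide +kernel

/-- At the end (√3, √3) of the curve both `dd` and `aa` vanish, and with them `massSlope`, so no
interval test of its sign can succeed there. Its coefficients with respect to `dd` and `aa` stay
positive. -/
theorem check_slopes_pos :
    zeroSetCheck (2 ^ 40) ff (fun ev => (ev slope₁).isPos && (ev slope₂).isPos) 40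
      (15 * 2 ^ 36) (7 * 2 ^ 38) (2 ^ 40) (4 * 2 ^ 40) = true := by decide +kernel

theorem check_slopeBracket_neg :
    zeroSetCheck (2 ^ 40) ff (fun ev => (ev slopeBracket).isNeg) 40
      (39 * 2 ^ 34) (5 * 2 ^ 37) (2 ^ 40) (4 * 2 ^ 40) = true := by decide +kernel

/-- Here x is a single point. This check and the next find opposite signs at two neighbours in the
grid of mesh 2^(-64), which traps the critical parameter between them. -/
theorem check_massSlope_neg_at : zeroSetCheck (2 ^ 96) ff (fun ev => (ev massSlope).isNeg) 99
    (11323674732956397696 * 2 ^ 32) (11323674732956397696 * 2 ^ 32)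
    (2 ^ 96) (4 * 2 ^ 96) = true := by
  decide +kernel

theorem check_massSlope_pos_at : zeroSetCheck (2 ^ 96) ff (fun ev => (ev massSlope).isPos) 99
    ((11323674732956397696 + 1) * 2 ^ 32) ((11323674732956397696 + 1) * 2 ^ 32)
    (2 ^ 96) (4 * 2 ^ 96) = true := by
  decide +kernel

/-- The two constants are 10^16 times 1.002713329037083 ∓ 5·10^(-16); multiplying by `vv` avoids the
division in the mass. -/
theorem check_mass : zeroSetCheck (2 ^ 96) ff (fun ev =>
    (ev (sub (mul (const (4 * 10027133290370825)) vv) (mul (const (10 ^ 16)) massNum))).isNeg &&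
    (ev (sub (mul (const (4 * 10027133290370835)) vv) (mul (const (10 ^ 16)) massNum))).isPos) 99
    (11323674732956397696 * 2 ^ 32) ((11323674732956397696 + 1) * 2 ^ 32)
    (2 ^ 96) (4 * 2 ^ 96) = true := by
  decide +kernel

/-! ### Identities and signs of the factors -/

theorem eval_aa (x y : ℝ) : aa.eval x y = 8 * invDist x ^ 3 - 1 := by
  simp [aa, eval, val]

theorem eval_bb (x y : ℝ) : bb.eval x y = 8 * invDist y ^ 3 - 1 := by
  simp [bb, eval, val]

theorem eval_uu (x y : ℝ) : uu.eval x y = 1 - ((y - x) * invDist x) ^ 3 := by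
  simp [uu, dd, eval, val, mul_pow]

theorem eval_vv (x y : ℝ) : vv.eval x y = 1 - ((y - x) * invDist y) ^ 3 := by
  simp [vv, dd, eval, val, mul_pow]

theorem eval_ff (x y : ℝ) :
    ff.eval x y = x * aa.eval x y * uu.eval x y + y * bb.eval x y * vv.eval x y := by
  simp [ff, eval, val, mul_assoc]

theorem eval_massNum (x y : ℝ) : massNum.eval x y = x * aa.eval x y * (y - x) ^ 2 := by
  simp [massNum, dd, eval, val, mul_assoc]

theorem eval_dx_ff (x y : ℝ) : ff.dx.eval x y = ffx.eval x y := by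
  simp only [ff, ffx, xp5, aa, bb, uu, vv, dd, dx, eval, val]
  push_cast
  ring

theorem eval_dy_ff (x y : ℝ) : ff.dy.eval x y = ffy.eval x y := by
  simp only [ff, ffy, yq5, aa, bb, uu, vv, dd, dy, eval, val]
  push_cast
  ring

/-- The derivative of `massNum / vv` along the curve `ff = 0`. -/
theorem eval_massSlope (x y : ℝ) :
    (massNum.dx.eval x y * ffy.eval x y - massNum.dy.eval x y * ffx.eval x y) * vv.eval x y -
      massNum.eval x y * (vv.dx.eval x y * ffy.eval x y - vv.dy.eval x y * ffx.eval x y) =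
    (y - x) * massSlope.eval x y := by
  simp only [massSlope, slopeMain, slopeTerm, slopeFactor, twoXV, massNum, aa, vv, dd, dx, dy, eval,
    val]
  -- The identity is formal in the two partial derivatives of the curve's equation, so their large
  -- expressions need not be expanded.
  generalize val x (invDist x) y (invDist y) ffx = fx
  generalize val x (invDist x) y (invDist y) ffy = fy
  push_cast
  ring

theorem eval_massSlope_eq (x y : ℝ) : massSlope.eval x y =
    dd.eval x y * slope₁.eval x y + aa.eval x y * slope₂.eval x y := by
  simp only [massSlope, slope₁, slope₂, eval, val]
  push_cast
  ring

theorem mul_invDist_sq (c x : ℝ) : (c * invDist x) ^ 2 * (1 + x ^ 2) = c ^ 2 := by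
  linear_combination c ^ 2 * invDist_sq x

theorem one_lt_mul_invDist_cube_iff {c x : ℝ} (hc : 0 ≤ c) :
    1 < (c * invDist x) ^ 3 ↔ 1 + x ^ 2 < c ^ 2 := by
  have hp := invDist_pos x
  rw [one_lt_pow_iff_of_nonneg (by positivity) (by norm_num),
    ← one_lt_sq_iff₀ (by positivity), ← mul_invDist_sq c x, lt_mul_iff_one_lt_left (by positivity)]

theorem mul_invDist_cube_lt_one_iff {c x : ℝ} (hc : 0 ≤ c) :
    (c * invDist x) ^ 3 < 1 ↔ c ^ 2 < 1 + x ^ 2 := by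
  have hp := invDist_pos x
  rw [pow_lt_one_iff_of_nonneg (by positivity) (by norm_num),
    ← sq_lt_one_iff₀ (by positivity), ← mul_invDist_sq c x, mul_lt_iff_lt_one_left (by positivity)]

theorem eight_mul_invDist_cube_sub_one_pos_iff {x : ℝ} : 0 < 8 * invDist x ^ 3 - 1 ↔ x ^ 2 < 3 := by
  have := one_lt_mul_invDist_cube_iff (c := 2) (x := x) (by norm_num)
  rw [mul_pow] at this
  rw [sub_pos]
  norm_num at this
  rw [this]
  constructor <;> intro h <;> linarith

theorem eight_mul_invDist_cube_sub_one_neg_iff {x : ℝ} : 8 * invDist x ^ 3 - 1 < 0 ↔ 3 < x ^ 2 := by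
  have := mul_invDist_cube_lt_one_iff (c := 2) (x := x) (by norm_num)
  rw [mul_pow] at this
  rw [sub_neg]
  norm_num at this
  rw [this]
  constructor <;> intro h <;> linarith

theorem eval_aa_pos_iff {x y : ℝ} : 0 < aa.eval x y ↔ x ^ 2 < 3 := by
  rw [eval_aa, eight_mul_invDist_cube_sub_one_pos_iff]

theorem eval_bb_pos_iff {x y : ℝ} : 0 < bb.eval x y ↔ y ^ 2 < 3 := by
  rw [eval_bb, eight_mul_invDist_cube_sub_one_pos_iff]

theorem eval_bb_neg_iff {x y : ℝ} : bb.eval x y < 0 ↔ 3 < y ^ 2 := by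
  rw [eval_bb, eight_mul_invDist_cube_sub_one_neg_iff]

theorem eval_uu_pos_iff {x y : ℝ} (h : x ≤ y) : 0 < uu.eval x y ↔ (y - x) ^ 2 < 1 + x ^ 2 := by
  rw [eval_uu, sub_pos, mul_invDist_cube_lt_one_iff (sub_nonneg.2 h)]

theorem eval_uu_neg_iff {x y : ℝ} (h : x ≤ y) : uu.eval x y < 0 ↔ 1 + x ^ 2 < (y - x) ^ 2 := by
  rw [eval_uu, sub_neg, one_lt_mul_invDist_cube_iff (sub_nonneg.2 h)]

theorem eval_vv_pos {x y : ℝ} (hx : 0 ≤ x) (h : x ≤ y) : 0 < vv.eval x y := by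
  rw [eval_vv, sub_pos, mul_invDist_cube_lt_one_iff (sub_nonneg.2 h)]
  nlinarith

/-! ### A priori bounds and signs on the curve -/

/-- The part of the zero set of `ff` that corresponds to concave kites. -/
structure OnKiteCurve (x y : ℝ) : Prop where
  pos : 0 < x
  lt : x < √3
  le : x ≤ y
  eq_zero : ff.eval x y = 0

theorem sq_lt_three {x : ℝ} (h0 : 0 < x) (h : x < √3) : x ^ 2 < 3 :=
  (Real.lt_sqrt h0.le).1 h

namespace OnKiteCurve

variable {x y : ℝ}

theorem aa_pos (h : OnKiteCurve x y) : 0 < aa.eval x y :=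
  eval_aa_pos_iff.2 (sq_lt_three h.pos h.lt)

theorem vv_pos (h : OnKiteCurve x y) : 0 < vv.eval x y := eval_vv_pos h.pos.le h.le

theorem y_pos (h : OnKiteCurve x y) : 0 < y := h.pos.trans_le h.le

/-- On the diagonal u = v = 1 and a = b, so the curve's equation would read 2 x a = 0, while x and a
are positive. -/
theorem xlt (h : OnKiteCurve x y) : x < y := by
  refine h.le.lt_of_ne fun he => ?_
  have h0 := h.eq_zero
  have ha := h.aa_pos
  have hx := h.pos
  rw [eval_ff, eval_bb, eval_uu, eval_vv, eval_aa] at h0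
  rw [eval_aa] at ha
  subst he
  rw [sub_self] at h0
  nlinarith [mul_pos hx ha]

/-- For y < 1 all of a, b, u, v are positive, and so is `ff`. -/
theorem one_le (h : OnKiteCurve x y) : 1 ≤ y := by
  by_contra! hy
  have hb : 0 < bb.eval x y := eval_bb_pos_iff.2 (by nlinarith [h.y_pos])
  have hu : 0 < uu.eval x y := (eval_uu_pos_iff h.le).2 (by nlinarith [h.pos, h.le])
  have h0 := h.eq_zero
  have := h.vv_pos
  have := h.aa_pos
  have := h.pos
  have := h.y_pos
  rw [eval_ff] at h0
  have : 0 < x * aa.eval x y * uu.eval x y + y * bb.eval x y * vv.eval x y := by positivity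
  exact this.ne' h0

/-- For y > 4 one has d > 2 and 1 + x² < 4, so u < 0; also b < 0, and both summands of `ff` are
negative. -/
theorem le_four (h : OnKiteCurve x y) : y ≤ 4 := by
  by_contra! hy
  have hx3 := sq_lt_three h.pos h.lt
  have hx2 : x < 2 := by nlinarith [h.pos]
  have hb : bb.eval x y < 0 := eval_bb_neg_iff.2 (by nlinarith)
  have hu : uu.eval x y < 0 := (eval_uu_neg_iff h.le).2 (by nlinarith [h.pos])
  have h0 := h.eq_zero
  rw [eval_ff] at h0
  nlinarith [mul_neg_of_pos_of_neg (mul_pos h.pos h.aa_pos) hu,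
    mul_pos_of_neg_of_neg (mul_neg_of_pos_of_neg h.y_pos hb) (neg_neg_of_pos h.vv_pos)]

/-- A property tested by `zeroSetCheck` holds on the curve. -/
theorem of_check {S : ℕ} (hS : 0 < S) {test : (KiteExpr → ScaledInterval) → Bool}
    {R : ℝ → ℝ → Prop}
    (htest : ∀ ev : KiteExpr → ScaledInterval, test ev = true → ∀ x y : ℝ,
      (∀ e' : KiteExpr, (ev e').Has S (e'.eval x y)) → R x y)
    {k xl xh : ℕ} (hc : zeroSetCheck S ff test k xl xh S (4 * S) = true) (h : OnKiteCurve x y)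
    (h1 : (xl : ℝ) ≤ x * S) (h2 : x * S ≤ xh) : R x y := by
  have hS' : (0 : ℝ) < S := by exact_mod_cast hS
  refine zeroSetCheck_sound hS htest hc ⟨h1, h2⟩ ⟨?_, ?_⟩ h.le h.eq_zero
  · nlinarith [h.one_le]
  · push_cast; nlinarith [h.le_four]

theorem lt_seven_fourths (h : OnKiteCurve x y) : x ≤ 7 / 4 := by
  nlinarith [sq_lt_three h.pos h.lt, h.pos]

theorem ffy_neg (h : OnKiteCurve x y) : ffy.eval x y < 0 :=
  h.of_check (R := fun x y => ffy.eval x y < 0) (by norm_num)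
    (fun _ ht _ _ hev => (hev _).neg_of_isNeg ht) check_ffy
    (by push_cast; nlinarith [h.pos]) (by push_cast; nlinarith [h.lt_seven_fourths])

theorem massSlope_neg (h : OnKiteCurve x y) (hx : x ≤ 39 / 64) : massSlope.eval x y < 0 :=
  h.of_check (R := fun x y => massSlope.eval x y < 0) (by norm_num)
    (fun _ ht _ _ hev => (hev _).neg_of_isNeg ht) check_massSlope_neg
    (by push_cast; nlinarith [h.pos]) (by push_cast; nlinarith)

theorem massSlope_pos (h : OnKiteCurve x y) (hx : 5 / 8 ≤ x) : 0 < massSlope.eval x y := by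
  rcases le_total x 1 with hx1 | hx1
  · exact h.of_check (R := fun x y => 0 < massSlope.eval x y) (by norm_num)
      (fun _ ht _ _ hev => (hev _).pos_of_isPos ht) check_massSlope_pos
      (by push_cast; nlinarith) (by push_cast; nlinarith)
  · have h12 : 0 < slope₁.eval x y ∧ 0 < slope₂.eval x y :=
      h.of_check (R := fun x y => 0 < slope₁.eval x y ∧ 0 < slope₂.eval x y) (by norm_num)
        (fun _ ht _ _ hev => by
          rw [Bool.and_eq_true] at ht
          exact ⟨(hev _).pos_of_isPos ht.1, (hev _).pos_of_isPos ht.2⟩) check_slopes_pos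
        (by push_cast; nlinarith) (by push_cast; nlinarith [h.lt_seven_fourths])
    have hd : 0 < dd.eval x y := sub_pos.2 h.xlt
    rw [eval_massSlope_eq]
    exact add_pos (mul_pos hd h12.1) (mul_pos h.aa_pos h12.2)

theorem slopeBracket_neg (h : OnKiteCurve x y) (h1 : 39 / 64 ≤ x) (h2 : x ≤ 5 / 8) :
    slopeBracket.eval x y < 0 :=
  h.of_check (R := fun x y => slopeBracket.eval x y < 0) (by norm_num)
    (fun _ ht _ _ hev => (hev _).neg_of_isNeg ht) check_slopeBracket_neg
    (by push_cast; nlinarith) (by push_cast; nlinarith)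

end OnKiteCurve

/-! ### The curve as a graph over (0, √3) -/

/-- A function whose derivative is negative at each of its zeros has at most one zero. -/
theorem eq_of_forall_zero_deriv_neg {f f' : ℝ → ℝ} {a b : ℝ}
    (hf : ∀ t ∈ Set.Icc a b, HasDerivAt f (f' t) t)
    (hneg : ∀ t ∈ Set.Icc a b, f t = 0 → f' t < 0) (ha : f a = 0) (hb : f b = 0)
    (hab : a ≤ b) : a = b := by
  refine hab.eq_of_not_lt fun hlt => ?_
  -- A function starting at 0 that decreases at each zero never becomes positive; but a negative
  -- derivative at the zero `b` makes it positive just to the left of `b`.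
  have hle : ∀ t ∈ Set.Icc a b, f t ≤ 0 := fun t ht =>
    image_le_of_deriv_right_lt_deriv_boundary (B := fun _ => 0) (B' := fun _ => 0)
      (fun s hs => (hf s hs).continuousAt.continuousWithinAt)
      (fun s hs => (hf s (Set.Ico_subset_Icc_self hs)).hasDerivWithinAt) ha.le
      (fun s => hasDerivAt_const s 0)
      (fun s hs h0 => hneg s (Set.Ico_subset_Icc_self hs) h0) ht
  have hbm : b ∈ Set.Icc a b := Set.right_mem_Icc.2 hab
  have hd := hneg b hbm hb
  have hmax : ∀ᶠ t in nhdsWithin b (Set.Iio b), slope f b t < 0 :=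
    ((hf b hbm).tendsto_slope.mono_left
      (nhdsWithin_mono b (fun t ht => ne_of_lt ht))).eventually_lt_const hd
  obtain ⟨t, ht1, ht2⟩ := (hmax.and (Ioo_mem_nhdsLT hlt)).exists
  have h1 := hle t ⟨ht2.1.le, ht2.2.le⟩
  rw [slope_def_field, hb, sub_zero] at ht1
  exact absurd ht1 (not_lt.2 (div_nonneg_of_nonpos h1 (by linarith [ht2.2])))

theorem KiteExpr.continuous_eval_right (e : KiteExpr) (x : ℝ) :
    Continuous (fun y => e.eval x y) :=
  (e.contDiff_eval (n := 0)).continuous.comp (by fun_prop : Continuous fun y : ℝ => (x, y))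

theorem hasDerivAt_ff_right (x y : ℝ) : HasDerivAt (fun t => ff.eval x t) (ffy.eval x y) y := by
  have := ff.hasDerivAt_eval (hasDerivAt_const y x) (hasDerivAt_id y)
  simpa [eval_dy_ff] using this

/-- Every zero of t ↦ ff(x, t) between the two ordinates also lies on the curve, where `ffy` is
negative. -/
theorem OnKiteCurve.unique {x y y' : ℝ} (h : OnKiteCurve x y) (h' : OnKiteCurve x y') :
    y = y' := by
  wlog hle : y ≤ y' generalizing y y'
  · exact (this h' h (le_of_not_ge hle)).symm
  exact eq_of_forall_zero_deriv_neg (f := fun t => ff.eval x t)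
    (fun t _ => hasDerivAt_ff_right x t)
    (fun t ht h0 => OnKiteCurve.ffy_neg ⟨h.pos, h.lt, h.le.trans ht.1, h0⟩) h.eq_zero h'.eq_zero hle

theorem exists_onKiteCurve {x : ℝ} (h0 : 0 < x) (h3 : x < √3) : ∃ y, OnKiteCurve x y := by
  have hx3 := sq_lt_three h0 h3
  have ha : ∀ y, 0 < aa.eval x y := fun y => eval_aa_pos_iff.2 hx3
  have hx2 : x < 2 := by nlinarith
  -- A point where `ff` is positive: y = 1 if x ≤ 1, where all factors are positive, and the
  -- diagonal point y = x otherwise. At y = 4 the sign is negative.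
  obtain ⟨y₀, hy0, hy4, hpos⟩ : ∃ y, x ≤ y ∧ y ≤ 4 ∧ 0 < ff.eval x y := by
    rcases le_total x 1 with h1 | h1
    · refine ⟨1, h1, by norm_num, ?_⟩
      have hb : 0 < bb.eval x 1 := eval_bb_pos_iff.2 (by norm_num)
      have hu : 0 < uu.eval x 1 := (eval_uu_pos_iff h1).2 (by nlinarith)
      have hv := eval_vv_pos h0.le h1
      have := ha 1
      rw [eval_ff]
      positivity
    · refine ⟨x, le_rfl, by linarith, ?_⟩
      have := ha x
      rw [eval_ff, eval_bb, eval_uu, eval_vv, eval_aa, sub_self]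
      rw [eval_aa] at this
      nlinarith [mul_pos h0 this]
  have hneg : ff.eval x 4 ≤ 0 := by
    have hx4 : x ≤ 4 := by linarith
    have hb : bb.eval x 4 < 0 := eval_bb_neg_iff.2 (by norm_num)
    have hu : uu.eval x 4 < 0 := (eval_uu_neg_iff hx4).2 (by nlinarith)
    have hv := eval_vv_pos h0.le hx4
    rw [eval_ff]
    nlinarith [mul_neg_of_pos_of_neg (mul_pos h0 (ha 4)) hu, mul_neg_of_neg_of_pos hb hv]
  obtain ⟨y, hy, hyz⟩ := intermediate_value_Icc' hy4
    (ff.continuous_eval_right x).continuousOn ⟨hneg, hpos.le⟩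
  exact ⟨y, h0, h3, hy0.trans hy.1, hyz⟩

open Classical in
/-- The function whose graph is the curve of concave kites. -/
noncomputable def kiteHeight (x : ℝ) : ℝ :=
  if h : 0 < x ∧ x < √3 then (exists_onKiteCurve h.1 h.2).choose else 0

theorem onKiteCurve_kiteHeight {x : ℝ} (h0 : 0 < x) (h3 : x < √3) :
    OnKiteCurve x (kiteHeight x) := by
  rw [kiteHeight, dif_pos ⟨h0, h3⟩]
  exact (exists_onKiteCurve h0 h3).choose_spec

theorem OnKiteCurve.eq_kiteHeight {x y : ℝ} (h : OnKiteCurve x y) : y = kiteHeight x :=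
  h.unique (onKiteCurve_kiteHeight h.pos h.lt)

theorem hasDerivAt_kiteHeight {x : ℝ} (h0 : 0 < x) (h3 : x < √3) :
    HasDerivAt kiteHeight (-(ffx.eval x (kiteHeight x) / ffy.eval x (kiteHeight x))) x := by
  have h := onKiteCurve_kiteHeight h0 h3
  obtain ⟨ψ, hψ0, hψ, hev⟩ := ff.exists_implicit h.eq_zero (by rw [eval_dy_ff]; exact h.ffy_neg.ne)
  rw [eval_dx_ff, eval_dy_ff] at hψ
  refine hψ.congr_of_eventuallyEq ?_
  -- The strict inequality x < y persists nearby, so the implicit function stays on the curve and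
  -- agrees with `kiteHeight` by uniqueness.
  have hlt : ∀ᶠ t in nhds x, t < ψ t :=
    continuousAt_id.eventually_lt hψ.continuousAt (by rw [hψ0]; exact h.xlt)
  filter_upwards [hev, hlt, lt_mem_nhds h0, gt_mem_nhds h3] with t ht1 ht2 ht3 ht4
  exact (OnKiteCurve.eq_kiteHeight ⟨ht3, ht4, ht2.le, ht1⟩).symm

/-- Differentiation along the curve of concave kites. -/
theorem KiteExpr.hasDerivAt_eval_kiteHeight (e : KiteExpr) {x : ℝ} (h0 : 0 < x) (h3 : x < √3) :
    HasDerivAt (fun t => e.eval t (kiteHeight t))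
      ((e.dx.eval x (kiteHeight x) * ffy.eval x (kiteHeight x) -
        e.dy.eval x (kiteHeight x) * ffx.eval x (kiteHeight x)) / ffy.eval x (kiteHeight x)) x := by
  have h := onKiteCurve_kiteHeight h0 h3
  refine (e.hasDerivAt_eval (hasDerivAt_id x) (hasDerivAt_kiteHeight h0 h3)).congr_deriv ?_
  have := h.ffy_neg.ne
  simp only [id]
  field_simp
  ring

/-! ### The mass along the curve and its unique critical point -/

/-- The mass `m` for which the kite of parameter `x` is a central configuration. -/
noncomputable def kiteMass (x : ℝ) : ℝ :=
  massNum.eval x (kiteHeight x) / (4 * vv.eval x (kiteHeight x))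

theorem hasDerivAt_kiteMass {x : ℝ} (h0 : 0 < x) (h3 : x < √3) :
    HasDerivAt kiteMass ((kiteHeight x - x) * massSlope.eval x (kiteHeight x) /
      (4 * vv.eval x (kiteHeight x) ^ 2 * ffy.eval x (kiteHeight x))) x := by
  have h := onKiteCurve_kiteHeight h0 h3
  have hv := h.vv_pos.ne'
  have hf := h.ffy_neg.ne
  have h1 := (massNum.hasDerivAt_eval_kiteHeight h0 h3).div
    ((vv.hasDerivAt_eval_kiteHeight h0 h3).const_mul 4) (mul_ne_zero four_ne_zero hv)
  refine h1.congr_deriv ?_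
  rw [← eval_massSlope]
  field_simp

theorem continuousAt_kiteMass {x : ℝ} (h0 : 0 < x) (h3 : x < √3) : ContinuousAt kiteMass x :=
  (hasDerivAt_kiteMass h0 h3).continuousAt

theorem massSlope_strictMonoOn :
    StrictMonoOn (fun t => massSlope.eval t (kiteHeight t)) (Set.Icc (39 / 64) (5 / 8)) := by
  have h3 : (5 / 8 : ℝ) < √3 := Real.lt_sqrt_of_sq_lt (by norm_num)
  have hd : ∀ t ∈ Set.Icc (39 / 64 : ℝ) (5 / 8), _ := fun t ht =>
    massSlope.hasDerivAt_eval_kiteHeight (x := t) (by linarith [ht.1]) (by linarith [ht.2])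
  refine strictMonoOn_of_deriv_pos (convex_Icc _ _)
    (fun t ht => (hd t ht).continuousAt.continuousWithinAt) fun t ht => ?_
  rw [interior_Icc] at ht
  have ht' := Set.Ioo_subset_Icc_self ht
  rw [(hd t ht').deriv]
  have h := onKiteCurve_kiteHeight (x := t) (by linarith [ht.1]) (by linarith [ht.2])
  exact div_pos_of_neg_of_neg (h.slopeBracket_neg ht'.1 ht'.2) h.ffy_neg

/-- The critical point of `kiteMass`, with a tight enclosure. -/
theorem exists_massSlope_eq_zero :
    ∃ c : ℝ, 11323674732956397696 ≤ c * 2 ^ 64 ∧ c * 2 ^ 64 ≤ 11323674732956397697 ∧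
      massSlope.eval c (kiteHeight c) = 0 := by
  have h3 : (1 : ℝ) < √3 := Real.lt_sqrt_of_sq_lt (by norm_num)
  have hcurve : ∀ t : ℝ, 0 < t → t < 1 → OnKiteCurve t (kiteHeight t) := fun t h0 h1 =>
    onKiteCurve_kiteHeight h0 (h1.trans h3)
  have hl : massSlope.eval (11323674732956397696 / 2 ^ 64)
      (kiteHeight (11323674732956397696 / 2 ^ 64)) < 0 :=
    (hcurve _ (by norm_num) (by norm_num)).of_check (R := fun x y => massSlope.eval x y < 0)
      (by norm_num) (fun _ ht _ _ hev => (hev _).neg_of_isNeg ht) check_massSlope_neg_at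
      (by norm_num) (by norm_num)
  have hr : 0 < massSlope.eval (11323674732956397697 / 2 ^ 64)
      (kiteHeight (11323674732956397697 / 2 ^ 64)) :=
    (hcurve _ (by norm_num) (by norm_num)).of_check (R := fun x y => 0 < massSlope.eval x y)
      (by norm_num) (fun _ ht _ _ hev => (hev _).pos_of_isPos ht) check_massSlope_pos_at
      (by norm_num) (by norm_num)
  obtain ⟨c, hc, hc0⟩ := intermediate_value_Icc
    (show (11323674732956397696 / 2 ^ 64 : ℝ) ≤ 11323674732956397697 / 2 ^ 64 by norm_num)
    (f := fun t => massSlope.eval t (kiteHeight t))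
    (fun t ht => (massSlope.hasDerivAt_eval_kiteHeight (x := t)
      (lt_of_lt_of_le (by norm_num) ht.1) (lt_of_le_of_lt (ht.2.trans (by norm_num)) h3)
      ).continuousAt.continuousWithinAt) ⟨hl.le, hr.le⟩
  exact ⟨c, by linarith [hc.1], by linarith [hc.2], hc0⟩

/-- The abscissa of the maximum of `kiteMass`. -/
noncomputable def criticalParameter : ℝ := exists_massSlope_eq_zero.choose

theorem le_criticalParameter : 11323674732956397696 ≤ criticalParameter * 2 ^ 64 :=
  exists_massSlope_eq_zero.choose_spec.1

theorem criticalParameter_le : criticalParameter * 2 ^ 64 ≤ 11323674732956397697 :=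
  exists_massSlope_eq_zero.choose_spec.2.1

theorem massSlope_criticalParameter :
    massSlope.eval criticalParameter (kiteHeight criticalParameter) = 0 :=
  exists_massSlope_eq_zero.choose_spec.2.2

theorem criticalParameter_mem_Icc : criticalParameter ∈ Set.Icc (39 / 64 : ℝ) (5 / 8) :=
  ⟨by linarith [le_criticalParameter], by linarith [criticalParameter_le]⟩

theorem criticalParameter_pos : 0 < criticalParameter := by
  linarith [criticalParameter_mem_Icc.1]

theorem criticalParameter_lt : criticalParameter < √3 :=
  criticalParameter_mem_Icc.2.trans_lt (Real.lt_sqrt_of_sq_lt (by norm_num))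

theorem massSlope_neg_of_lt {x : ℝ} (h0 : 0 < x) (hx : x < criticalParameter) :
    massSlope.eval x (kiteHeight x) < 0 := by
  rcases le_total x (39 / 64) with h | h
  · exact (onKiteCurve_kiteHeight h0 (hx.trans criticalParameter_lt)).massSlope_neg h
  · rw [← massSlope_criticalParameter]
    exact massSlope_strictMonoOn ⟨h, hx.le.trans criticalParameter_mem_Icc.2⟩
      criticalParameter_mem_Icc hx

theorem massSlope_pos_of_gt {x : ℝ} (hx : criticalParameter < x) (h3 : x < √3) :
    0 < massSlope.eval x (kiteHeight x) := by
  rcases le_total x (5 / 8) with h | h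
  · rw [← massSlope_criticalParameter]
    exact massSlope_strictMonoOn criticalParameter_mem_Icc
      ⟨criticalParameter_mem_Icc.1.trans hx.le, h⟩ hx
  · exact (onKiteCurve_kiteHeight (criticalParameter_pos.trans hx) h3).massSlope_pos h

theorem kiteMass_strictMonoOn : StrictMonoOn kiteMass (Set.Ioc 0 criticalParameter) := by
  refine strictMonoOn_of_deriv_pos (convex_Ioc _ _) (fun t ht => (continuousAt_kiteMass ht.1
    (ht.2.trans_lt criticalParameter_lt)).continuousWithinAt) fun t ht => ?_
  rw [interior_Ioc] at ht
  have h3 := ht.2.trans criticalParameter_lt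
  have h := onKiteCurve_kiteHeight ht.1 h3
  rw [(hasDerivAt_kiteMass ht.1 h3).deriv]
  exact div_pos_of_neg_of_neg
    (mul_neg_of_pos_of_neg (sub_pos.2 h.xlt) (massSlope_neg_of_lt ht.1 ht.2))
    (mul_neg_of_pos_of_neg (by have := h.vv_pos; positivity) h.ffy_neg)

theorem kiteMass_strictAntiOn : StrictAntiOn kiteMass (Set.Ico criticalParameter √3) := by
  refine strictAntiOn_of_deriv_neg (convex_Ico _ _) (fun t ht => (continuousAt_kiteMass
    (criticalParameter_pos.trans_le ht.1) ht.2).continuousWithinAt) fun t ht => ?_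
  rw [interior_Ico] at ht
  have h0 := criticalParameter_pos.trans ht.1
  have h := onKiteCurve_kiteHeight h0 ht.2
  rw [(hasDerivAt_kiteMass h0 ht.2).deriv]
  exact div_neg_of_pos_of_neg
    (mul_pos (sub_pos.2 h.xlt) (massSlope_pos_of_gt ht.1 ht.2))
    (mul_neg_of_pos_of_neg (by have := h.vv_pos; positivity) h.ffy_neg)

theorem kiteMass_criticalParameter_bounds :
    10027133290370825 / 10 ^ 16 < kiteMass criticalParameter ∧
      kiteMass criticalParameter < 10027133290370835 / 10 ^ 16 := by
  have h := onKiteCurve_kiteHeight criticalParameter_pos criticalParameter_lt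
  have hv := h.vv_pos
  have hb := h.of_check (R := fun x y =>
      4 * 10027133290370825 * vv.eval x y - 10 ^ 16 * massNum.eval x y < 0 ∧
      0 < 4 * 10027133290370835 * vv.eval x y - 10 ^ 16 * massNum.eval x y)
    (by norm_num) (fun ev ht x y hev => by
      rw [Bool.and_eq_true] at ht
      have h1 := (hev _).neg_of_isNeg ht.1
      have h2 := (hev _).pos_of_isPos ht.2
      simp only [eval, val] at h1 h2
      push_cast at h1 h2
      simp only [eval]
      constructor <;> linarith) check_mass
    (by push_cast; linarith [le_criticalParameter]) (by push_cast; linarith [criticalParameter_le])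
  unfold kiteMass
  constructor
  · rw [lt_div_iff₀ (by positivity)]
    linarith [hb.1]
  · rw [div_lt_iff₀ (by positivity)]
    linarith [hb.2]

/-! ### Behaviour at the ends and fibres of the mass -/

/-- From y ≤ 4 follow (d q)² ≤ 16/17, hence v ≥ 1/17, and d² ≤ 16; the constant is 16 · 17 / 4. The
bound vanishes at x = 0 and x = √3, so the mass tends to 0 at both ends. -/
theorem kiteMass_le {x : ℝ} (h0 : 0 < x) (h3 : x < √3) :
    kiteMass x ≤ 68 * (x * (8 * invDist x ^ 3 - 1)) := by
  have h := onKiteCurve_kiteHeight h0 h3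
  unfold kiteMass
  set y := kiteHeight x
  have ha := h.aa_pos
  have hv := h.vv_pos
  have h1 := h.one_le
  have h4 := h.le_four
  have hlt := h.xlt
  have hq := invDist_pos y
  have hd : 0 < (y - x) * invDist y := mul_pos (sub_pos.2 hlt) hq
  have hsq : ((y - x) * invDist y) ^ 2 * 17 ≤ 16 := by
    have e := mul_invDist_sq (y - x) y
    have e1 : (y - x) ^ 2 ≤ y ^ 2 := by nlinarith
    have e2 := mul_invDist_sq y y
    have e3 : (y * invDist y) ^ 2 * 17 ≤ 16 := by
      have e4 := invDist_sq y
      have e5 : 1 ≤ 17 * invDist y ^ 2 := by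
        nlinarith [mul_nonneg (sq_nonneg (invDist y)) (show (0 : ℝ) ≤ 16 - y ^ 2 by nlinarith)]
      nlinarith
    refine le_trans ?_ e3
    rw [mul_pow, mul_pow]
    gcongr
  have hv17 : 1 ≤ 17 * vv.eval x y := by
    rw [eval_vv]
    have : (y - x) * invDist y ≤ 1 := by nlinarith
    nlinarith [mul_nonneg (sq_nonneg ((y - x) * invDist y)) (sub_nonneg.2 this)]
  rw [div_le_iff₀ (by positivity), eval_massNum, ← eval_aa x y]
  have hxa := mul_pos h0 ha
  have hd2 : (y - x) ^ 2 ≤ 16 := by nlinarith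
  calc x * aa.eval x y * (y - x) ^ 2 ≤ x * aa.eval x y * 16 := by gcongr
    _ ≤ 68 * (x * aa.eval x y) * (4 * vv.eval x y) := by nlinarith

theorem exists_kiteMass_lt {m : ℝ} (hm : 0 < m) :
    (∃ x, 0 < x ∧ x < criticalParameter ∧ kiteMass x < m) ∧
      ∃ x, criticalParameter < x ∧ x < √3 ∧ kiteMass x < m := by
  have hcont : Continuous fun x : ℝ => 68 * (x * (8 * invDist x ^ 3 - 1)) := by
    have := (contDiff_invDist (n := 0)).continuous
    fun_prop
  have h3 : (0 : ℝ) < √3 := by positivity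
  have hz : 8 * invDist √3 ^ 3 - 1 = 0 := by
    refine le_antisymm (not_lt.1 fun h => ?_) (not_lt.1 fun h => ?_)
    · have := eight_mul_invDist_cube_sub_one_pos_iff.1 h
      simp at this
    · have := eight_mul_invDist_cube_sub_one_neg_iff.1 h
      simp at this
  constructor
  · have hev : ∀ᶠ x in nhdsWithin 0 (Set.Ioi 0), 68 * (x * (8 * invDist x ^ 3 - 1)) < m :=
      (hcont.continuousAt.eventually_lt_const (by simpa using hm)).filter_mono nhdsWithin_le_nhds
    obtain ⟨x, hx, hxm⟩ := (hev.and (Ioo_mem_nhdsGT criticalParameter_pos)).exists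
    exact ⟨x, hxm.1, hxm.2, (kiteMass_le hxm.1 (hxm.2.trans criticalParameter_lt)).trans_lt hx⟩
  · have hev : ∀ᶠ x in nhdsWithin √3 (Set.Iio √3), 68 * (x * (8 * invDist x ^ 3 - 1)) < m :=
      (hcont.continuousAt.eventually_lt_const (by beta_reduce; rw [hz]; simpa using hm)).filter_mono
        nhdsWithin_le_nhds
    obtain ⟨x, hx, hxm⟩ := (hev.and (Ioo_mem_nhdsLT criticalParameter_lt)).exists
    exact ⟨x, hxm.1, hxm.2, (kiteMass_le (criticalParameter_pos.trans hxm.1) hxm.2).trans_lt hx⟩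

theorem encard_kiteMass_fiber_eq_two {m : ℝ} (h0 : 0 < m) (h1 : m < kiteMass criticalParameter) :
    {x | (0 < x ∧ x < √3) ∧ kiteMass x = m}.encard = 2 := by
  obtain ⟨⟨a, ha0, hac, ham⟩, b, hcb, hb3, hbm⟩ := exists_kiteMass_lt h0
  obtain ⟨x, hx, hxm⟩ := intermediate_value_Icc hac.le
    (fun t ht => (continuousAt_kiteMass (ha0.trans_le ht.1)
      (ht.2.trans_lt criticalParameter_lt)).continuousWithinAt) ⟨ham.le, h1.le⟩
  obtain ⟨y, hy, hym⟩ := intermediate_value_Icc' hcb.le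
    (fun t ht => (continuousAt_kiteMass (criticalParameter_pos.trans_le ht.1)
      (ht.2.trans_lt hb3)).continuousWithinAt) ⟨hbm.le, h1.le⟩
  have hx0 : 0 < x := ha0.trans_le hx.1
  have hy3 : y < √3 := hy.2.trans_lt hb3
  have hxc : x < criticalParameter := hx.2.lt_of_ne (by rintro rfl; exact h1.ne' hxm)
  have hcy : criticalParameter < y := hy.1.lt_of_ne (by rintro h; rw [← h] at hym; exact h1.ne' hym)
  rw [Set.encard_eq_two]
  refine ⟨x, y, (hxc.trans hcy).ne, Set.Subset.antisymm ?_ ?_⟩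
  · rintro z ⟨⟨hz0, hz3⟩, hzm⟩
    rcases le_total z criticalParameter with h | h
    · exact .inl (kiteMass_strictMonoOn.injOn ⟨hz0, h⟩ ⟨hx0, hxc.le⟩ (hzm.trans hxm.symm))
    · exact .inr (kiteMass_strictAntiOn.injOn ⟨h, hz3⟩ ⟨hcy.le, hy3⟩ (hzm.trans hym.symm))
  · rintro z (rfl | rfl)
    · exact ⟨⟨hx0, hxc.trans criticalParameter_lt⟩, hxm⟩
    · exact ⟨⟨criticalParameter_pos.trans hcy, hy3⟩, hym⟩

theorem kiteMass_lt_max {x : ℝ} (h0 : 0 < x) (h3 : x < √3) (hne : x ≠ criticalParameter) :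
    kiteMass x < kiteMass criticalParameter := by
  rcases hne.lt_or_gt with h | h
  · exact kiteMass_strictMonoOn ⟨h0, h.le⟩ ⟨criticalParameter_pos, le_rfl⟩ h
  · exact kiteMass_strictAntiOn ⟨le_rfl, criticalParameter_lt⟩ ⟨h.le, h3⟩ h

/-! ### Central configurations and kites in normal form -/

/-- The omitted terms are 0 anyway: for i = j the vector vanishes, for a massless body the
coefficient does. -/
theorem IsCentralConfiguration.sum_eq {n : ℕ} (μ : Fin n → ℝ) (q : Fin n → ℂ) (j : Fin n) :
    ∑ i with i ≠ j ∧ μ i ≠ 0, (μ i / dist (q i) (q j) ^ 3) • (q j - q i) =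
      ∑ i, (μ i / dist (q i) (q j) ^ 3) • (q j - q i) := by
  refine Finset.sum_subset (Finset.filter_subset _ _) fun i _ hi => ?_
  by_cases hij : i = j
  · simp [hij]
  · have : μ i = 0 := by simpa [hij] using hi
    simp [this]

/-- Central configurations are invariant under similarities. -/
theorem isCentralConfiguration_affine_iff {n : ℕ} {μ : Fin n → ℝ} (hμ : ∑ i, μ i ≠ 0)
    {h : ℂ} (hh : h ≠ 0) (c : ℂ) (q : Fin n → ℂ) :
    IsCentralConfiguration μ (fun i => c + h * q i) ↔ IsCentralConfiguration μ q := by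
  have hcom : centerOfMass μ (fun i => c + h * q i) = c + h * centerOfMass μ q := by
    have hμ' : (∑ i, (μ i : ℂ)) ≠ 0 := by exact_mod_cast hμ
    simp only [centerOfMass, Complex.real_smul, mul_add, Finset.sum_add_distrib, ← Finset.sum_mul]
    push_cast
    rw [← mul_assoc, inv_mul_cancel₀ hμ', one_mul, Finset.mul_sum, Finset.mul_sum, Finset.mul_sum]
    congr 1
    exact Finset.sum_congr rfl fun i _ => by ring
  have hn : (0 : ℝ) < ‖h‖ ^ 3 := by positivity
  have hsum : ∀ j, ∑ i, (μ i / dist (c + h * q i) (c + h * q j) ^ 3) •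
      ((c + h * q j) - (c + h * q i)) =
      (‖h‖ ^ 3)⁻¹ • (h * ∑ i, (μ i / dist (q i) (q j) ^ 3) • (q j - q i)) := fun j => by
    rw [Finset.mul_sum, Finset.smul_sum]
    refine Finset.sum_congr rfl fun i _ => ?_
    rw [dist_add_left, dist_eq_norm, ← mul_sub, norm_mul, ← dist_eq_norm, mul_pow,
      div_mul_eq_div_div_swap, add_sub_add_left_eq_sub, ← mul_sub, mul_smul_comm, smul_smul]
    congr 1
    rw [div_div, inv_mul_eq_div, div_div, mul_comm]
  unfold IsCentralConfiguration
  refine and_congr ?_ ?_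
  · simp [hh]
  · simp only [IsCentralConfiguration.sum_eq, hcom, hsum]
    -- Stretching by `‖h‖` only rescales the multiplier, by the factor `‖h‖ ^ 3`.
    have key : ∀ (lam : ℝ) (z w : ℂ), lam • (h * z) = (‖h‖ ^ 3)⁻¹ • (h * w) ↔
        (lam * ‖h‖ ^ 3) • z = w := fun lam z w => by
      rw [mul_smul, eq_inv_smul_iff₀ hn.ne', smul_comm, ← mul_smul_comm, ← mul_smul_comm,
        mul_right_inj' hh, smul_smul]
    have hz : ∀ j, c + h * q j - (c + h * centerOfMass μ q) = h * (q j - centerOfMass μ q) :=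
      fun j => by ring
    simp only [hz, key]
    constructor
    · rintro ⟨lam, hl⟩
      exact ⟨_, hl⟩
    · rintro ⟨lam, hl⟩
      exact ⟨lam / ‖h‖ ^ 3, by simpa [hn.ne'] using hl⟩

/-- The kite with base `-1`, `1` and its other bodies at `x i` and `y i`. -/
noncomputable def standardKite (x y : ℝ) : Fin 4 → ℂ :=
  ![-1, 1, x * Complex.I, y * Complex.I]

/-- The kite with base `c - h`, `c + h`. -/
noncomputable def kite (c h : ℂ) (x y : ℝ) : Fin 4 → ℂ := fun i => c + h * standardKite x y i

theorem standardKite_eq_kite (x y : ℝ) : standardKite x y = kite 0 1 x y := by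
  ext i
  simp [kite]

/-- The force equations of a kite. -/
def KiteEquations (m x y : ℝ) : Prop :=
  ∃ l : ℝ, l = 1 / 4 + m * invDist x ^ 3 + m * invDist y ^ 3 ∧
    l * (m * (x + y) / (2 + 2 * m)) = m * (x * invDist x ^ 3 + y * invDist y ^ 3) ∧
    l * (x - m * (x + y) / (2 + 2 * m)) = 2 * x * invDist x ^ 3 + m * (x - y) / |x - y| ^ 3 ∧
    l * (y - m * (x + y) / (2 + 2 * m)) = 2 * y * invDist y ^ 3 + m * (y - x) / |x - y| ^ 3

theorem norm_eq_inv_invDist {z : ℂ} {x : ℝ} (h : z.re ^ 2 + z.im ^ 2 = 1 + x ^ 2) :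
    ‖z‖ = (invDist x)⁻¹ := by
  rw [invDist, inv_inv, Complex.norm_eq_sqrt_sq_add_sq, h]

theorem isCentralConfiguration_standardKite_iff {m : ℝ} (hm : 0 ≤ m) (x y : ℝ) :
    IsCentralConfiguration (pairMass m) (standardKite x y) ↔
      (m ≠ 0 → x ≠ y) ∧ KiteEquations m x y := by
  obtain ⟨g, hg⟩ : ∃ g, g = m * (x + y) / (2 + 2 * m) := ⟨_, rfl⟩
  have hcom : centerOfMass (pairMass m) (standardKite x y) = (g : ℂ) * Complex.I := by
    have h2' : (1 + 1 + m + m : ℝ) ≠ 0 := by positivity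
    rw [eq_div_iff (by positivity)] at hg
    rw [centerOfMass, inv_smul_eq_iff₀ (by simpa [pairMass, Fin.sum_univ_four] using h2')]
    simp only [pairMass, standardKite, Fin.sum_univ_four]
    apply Complex.ext
    · simp
    · simp
      linarith
  have d01 : dist (-1 : ℂ) 1 = 2 := by
    rw [dist_eq_norm]; norm_num
  have d02 : ∀ t : ℝ, dist (-1 : ℂ) (t * Complex.I) = (invDist t)⁻¹ := fun t => by
    rw [dist_eq_norm]; exact norm_eq_inv_invDist (by simp)
  have d12 : ∀ t : ℝ, dist (1 : ℂ) (t * Complex.I) = (invDist t)⁻¹ := fun t => by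
    rw [dist_eq_norm]; exact norm_eq_inv_invDist (by simp)
  have d23 : dist (x * Complex.I) (y * Complex.I) = |x - y| := by
    rw [dist_eq_norm, ← sub_mul, norm_mul, Complex.norm_I, mul_one, ← Complex.ofReal_sub,
      Complex.norm_real, Real.norm_eq_abs]
  unfold IsCentralConfiguration
  refine and_congr ?_ ?_
  · constructor
    · intro h hm0 hxy
      exact h 2 3 (by decide) (.inl (by simpa [pairMass] using hm0))
        (by simp [standardKite, hxy])
    · intro h i j hij hμ heq
      fin_cases i <;> fin_cases j <;>
        simp [standardKite, pairMass, Complex.ext_iff] at hij hμ heq <;> first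
          | exact h hμ heq
          | exact h hμ heq.symm
          | norm_num at heq
  · simp only [IsCentralConfiguration.sum_eq, hcom]
    unfold KiteEquations
    simp only [← hg]
    have hinv : ∀ a t : ℝ, a / (invDist t)⁻¹ ^ 3 = a * invDist t ^ 3 := fun a t => by
      rw [inv_pow, div_inv_eq_mul]
    have h8 : (1 : ℝ) / 2 ^ 3 = 1 / 8 := by norm_num
    simp only [Fin.forall_fin_succ, IsEmpty.forall_iff, and_true, Fin.sum_univ_four, pairMass,
      standardKite, Matrix.cons_val_zero, Matrix.cons_val_one, Matrix.cons_val,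
      Fin.succ_zero_eq_one, Fin.succ_one_eq_two, Fin.reduceSucc, dist_self, d01, d02, d12, d23, dist_comm _ (1 : ℂ),
      dist_comm _ (-1 : ℂ), dist_comm (y * Complex.I) (x * Complex.I), hinv, h8, sub_self,
      Complex.ext_iff, Complex.add_re, Complex.add_im, Complex.sub_re, Complex.sub_im,
      Complex.smul_re, Complex.smul_im, smul_eq_mul, Complex.re_ofReal_mul, Complex.im_ofReal_mul,
      Complex.I_re, Complex.I_im, Complex.neg_re, Complex.neg_im, Complex.one_re, Complex.one_im]
    have hc : m * (x - y) / |x - y| ^ 3 = m / |x - y| ^ 3 * (x - y) := by ring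
    have hc' : m * (y - x) / |x - y| ^ 3 = m / |x - y| ^ 3 * (y - x) := by ring
    rw [hc, hc']
    refine exists_congr fun l => ⟨fun h => ?_, fun h => ?_⟩
    -- Body 2 repeats the equations of body 1 by reflection, and the real parts for bodies 3 and 4
    -- are trivial.
    · obtain ⟨⟨h0, h1⟩, -, ⟨-, h2⟩, -, h3⟩ := h
      refine ⟨?_, ?_, ?_, ?_⟩ <;> linarith
    · obtain ⟨h0, h1, h2, h3⟩ := h
      refine ⟨⟨?_, ?_⟩, ⟨?_, ?_⟩, ⟨?_, ?_⟩, ?_, ?_⟩ <;> linarith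

theorem kite_zero (c h : ℂ) (x y : ℝ) : kite c h x y 0 = c - h := by
  simp [kite, standardKite, sub_eq_add_neg]

theorem kite_one (c h : ℂ) (x y : ℝ) : kite c h x y 1 = c + h := by
  simp [kite, standardKite]

theorem kite_two (c h : ℂ) (x y : ℝ) : kite c h x y 2 = c + h * (x * Complex.I) := by
  simp [kite, standardKite]

theorem kite_three (c h : ℂ) (x y : ℝ) : kite c h x y 3 = c + h * (y * Complex.I) := by
  simp [kite, standardKite]

theorem exists_eq_of_mem_perpBisector {c h z : ℂ} (hh : h ≠ 0)
    (hz : z ∈ AffineSubspace.perpBisector (c - h) (c + h)) :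
    ∃ x : ℝ, z = c + h * (x * Complex.I) := by
  obtain ⟨w, rfl⟩ : ∃ w, z = c + h * w := ⟨(z - c) / h, by field_simp; ring⟩
  rw [AffineSubspace.mem_perpBisector_iff_dist_eq, dist_eq_norm, dist_eq_norm,
    show c + h * w - (c - h) = h * (w + 1) by ring, show c + h * w - (c + h) = h * (w - 1) by ring,
    norm_mul, norm_mul, mul_right_inj' (norm_ne_zero_iff.2 hh), ← sq_eq_sq₀ (norm_nonneg _)
    (norm_nonneg _), Complex.sq_norm, Complex.sq_norm, Complex.normSq_apply,
    Complex.normSq_apply] at hz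
  simp at hz
  have h0 : w.re = 0 := by linarith
  exact ⟨w.im, by congr 2; apply Complex.ext <;> simp [h0]⟩

theorem mem_perpBisector (c h : ℂ) (x : ℝ) :
    c + h * (x * Complex.I) ∈ AffineSubspace.perpBisector (c - h) (c + h) := by
  rw [AffineSubspace.mem_perpBisector_iff_dist_eq, dist_eq_norm, dist_eq_norm,
    show c + h * (x * Complex.I) - (c - h) = h * (1 + x * Complex.I) by ring,
    show c + h * (x * Complex.I) - (c + h) = h * (-1 + x * Complex.I) by ring, norm_mul, norm_mul]
  congr 1
  rw [norm_eq_inv_invDist (x := x) (by simp), norm_eq_inv_invDist (x := x) (by simp)]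

theorem exists_eq_kite {q : Fin 4 → ℂ} (h01 : q 0 ≠ q 1)
    (h2 : q 2 ∈ AffineSubspace.perpBisector (q 0) (q 1))
    (h3 : q 3 ∈ AffineSubspace.perpBisector (q 0) (q 1)) :
    ∃ (c h : ℂ) (x y : ℝ), h ≠ 0 ∧ q = kite c h x y := by
  have hh : (q 1 - q 0) / 2 ≠ 0 := div_ne_zero (sub_ne_zero.2 h01.symm) two_ne_zero
  have e0 : q 0 = (q 0 + q 1) / 2 - (q 1 - q 0) / 2 := by ring
  have e1 : q 1 = (q 0 + q 1) / 2 + (q 1 - q 0) / 2 := by ring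
  generalize (q 0 + q 1) / 2 = c at *
  generalize (q 1 - q 0) / 2 = h at *
  rw [e0, e1] at h2 h3
  obtain ⟨x, hx⟩ := exists_eq_of_mem_perpBisector hh h2
  obtain ⟨y, hy⟩ := exists_eq_of_mem_perpBisector hh h3
  refine ⟨c, h, x, y, hh, ?_⟩
  ext i
  fin_cases i
  · exact e0.trans (kite_zero c h x y).symm
  · exact e1.trans (kite_one c h x y).symm
  · exact hx.trans (kite_two c h x y).symm
  · exact hy.trans (kite_three c h x y).symm

/-! ### Collinearity and concavity in coordinates -/

theorem isKite_kite_iff {c h : ℂ} (hh : h ≠ 0) (x y : ℝ) :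
    IsKite (kite c h x y) ↔ ¬ (x = 0 ∧ y = 0) := by
  have hcol : Collinear ℝ (Set.range (kite c h x y)) ↔ x = 0 ∧ y = 0 := by
    rw [collinear_iff_of_mem (Set.mem_range_self 0)]
    constructor
    · rintro ⟨v, hv⟩
      obtain ⟨r, hr⟩ := hv _ (Set.mem_range_self 1)
      have key : ∀ t s : ℝ, c + h * (t * Complex.I) = s • v +ᵥ (c - h) → t = 0 := fun t s hs => by
        rw [kite_zero, kite_one] at hr
        simp only [vadd_eq_add, Complex.real_smul] at hr hs
        have e1 : (r : ℂ) * v = 2 * h := by linear_combination -hr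
        have e2 : (s : ℂ) * v = h * (1 + t * Complex.I) := by linear_combination -hs
        have e3 : h * (2 * s) = h * (r * (1 + t * Complex.I)) := by
          linear_combination r * e2 - s * e1
        have e4 := mul_left_cancel₀ hh e3
        have hr0 : r ≠ 0 := by
          rintro rfl
          simp [hh] at e1
        have := congrArg Complex.im e4
        simp at this
        tauto
      obtain ⟨s, hs⟩ := hv _ (Set.mem_range_self 2)
      obtain ⟨t, ht⟩ := hv _ (Set.mem_range_self 3)
      rw [kite_zero] at hs ht
      rw [kite_two] at hs
      rw [kite_three] at ht
      exact ⟨key x s hs, key y t ht⟩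
    · rintro ⟨rfl, rfl⟩
      refine ⟨h, ?_⟩
      rintro _ ⟨i, rfl⟩
      rw [kite_zero]
      fin_cases i
      · exact ⟨0, by simp [kite_zero]⟩
      · refine ⟨2, ?_⟩
        simp [kite_one]
        ring
      · exact ⟨1, by simp [kite_two]⟩
      · exact ⟨1, by simp [kite_three]⟩
  unfold IsKite
  rw [hcol]
  refine and_iff_left ⟨?_, ?_, ?_⟩
  · rw [kite_zero, kite_one]
    intro he
    exact hh (by linear_combination -he / 2)
  · rw [kite_zero, kite_one, kite_two]
    exact mem_perpBisector c h x
  · rw [kite_zero, kite_one, kite_three]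
    exact mem_perpBisector c h y

/-- The normalizing map w ↦ (w - c) / h is affine, so convex sets in normalized coordinates pull
back to convex sets. It turns hull membership into bounds on real or imaginary parts. -/
theorem div_sub_mem_of_mem_convexHull {c h z : ℂ} {s : Set ℂ} {t : Set ℂ} (ht : Convex ℝ t)
    (hs : ∀ w ∈ s, (w - c) / h ∈ t) (hz : z ∈ convexHull ℝ s) : (z - c) / h ∈ t := by
  refine convexHull_min (t := {w | (w - c) / h ∈ t}) hs ?_ hz
  intro u hu v hv a b ha hb hab
  have hab' : (a : ℂ) + b = 1 := by exact_mod_cast hab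
  have e : (a • u + b • v - c) / h = a • ((u - c) / h) + b • ((v - c) / h) := by
    simp only [Complex.real_smul]
    linear_combination (c / h) * hab'
  rw [Set.mem_ofPred_eq, e]
  exact ht hu hv ha hb hab

theorem kite_two_mem_convexHull_iff {c h : ℂ} (hh : h ≠ 0) {x y : ℝ} :
    kite c h x y 2 ∈ convexHull ℝ {kite c h x y 0, kite c h x y 1, kite c h x y 3} ↔
      x ∈ Set.uIcc 0 y := by
  rw [kite_zero, kite_one, kite_two, kite_three]
  constructor
  · intro hmem
    have := div_sub_mem_of_mem_convexHull (c := c) (h := h) (t := Complex.im ⁻¹' Set.uIcc 0 y)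
      ((convex_uIcc 0 y).is_linear_preimage Complex.imLm.isLinear) ?_ hmem
    · simpa [hh] using this
    · rintro w (rfl | rfl | rfl) <;> simp [hh]
  · rw [← segment_eq_uIcc]
    rintro ⟨a, b, ha, hb, hab, rfl⟩
    have hab' : (a : ℂ) + b = 1 := by exact_mod_cast hab
    have hm := (convex_convexHull ℝ {c - h, c + h, c + h * (y * Complex.I)}).sum_mem
      -- The height 0 is the midpoint of the base, so its weight `a` is shared equally by the two
      -- base points.
      (t := Finset.univ) (w := ![a / 2, a / 2, b])
      (z := ![c - h, c + h, c + h * (y * Complex.I)]) ?_ ?_ ?_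
    · convert hm using 1
      simp [Fin.sum_univ_three, -smul_add]
      linear_combination -c * hab'
    · intro i _
      fin_cases i <;> simp <;> linarith
    · simp [Fin.sum_univ_three]; linarith
    · intro i _
      refine subset_convexHull ℝ _ ?_
      fin_cases i <;> simp

theorem kite_swap (c h : ℂ) (x y : ℝ) : kite c h y x = kite c h x y ∘ Equiv.swap 2 3 := by
  ext i
  fin_cases i
  · simp [kite_zero, Equiv.swap_apply_of_ne_of_ne]
  · simp [kite_one, Equiv.swap_apply_of_ne_of_ne]
  · simp [kite_two, kite_three]
  · simp [kite_two, kite_three]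

/-- Each base point is a strict extreme of the normalized real part, so only body 3 or 4 can lie in
the hull of the others; this means that one height lies between 0 and the other. -/
theorem isConcave_kite_iff {c h : ℂ} (hh : h ≠ 0) (x y : ℝ) :
    IsConcave (kite c h x y) ↔ 0 ≤ x * y := by
  have himg2 : kite c h x y '' {j | j ≠ 2} =
      {kite c h x y 0, kite c h x y 1, kite c h x y 3} := by
    have : {j : Fin 4 | j ≠ 2} = {0, 1, 3} := by ext j; fin_cases j <;> simp
    rw [this, Set.image_insert_eq, Set.image_pair]
  have himg3 : kite c h x y '' {j | j ≠ 3} =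
      {kite c h y x 0, kite c h y x 1, kite c h y x 3} := by
    have : {j : Fin 4 | j ≠ 3} = {0, 1, 2} := by ext j; fin_cases j <;> simp
    rw [this, Set.image_insert_eq, Set.image_pair, kite_zero, kite_zero, kite_one, kite_one,
      kite_two, kite_three]
  have h3 : kite c h x y 3 = kite c h y x 2 := by rw [kite_two, kite_three]
  constructor
  · rintro ⟨i, hi⟩
    fin_cases i
    · have := div_sub_mem_of_mem_convexHull (c := c) (h := h) (t := {w | 0 ≤ w.re})
        (convex_halfSpace_ge Complex.reLm.isLinear 0) ?_ hi
      · simp [kite_zero, hh] at this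
        linarith
      · rintro _ ⟨j, hj, rfl⟩
        fin_cases j <;> simp [kite_one, kite_two, kite_three, hh] at hj ⊢
    · have := div_sub_mem_of_mem_convexHull (c := c) (h := h) (t := {w | w.re ≤ 0})
        (convex_halfSpace_le Complex.reLm.isLinear 0) ?_ hi
      · simp [kite_one, hh] at this
        linarith
      · rintro _ ⟨j, hj, rfl⟩
        fin_cases j <;> simp [kite_zero, kite_two, kite_three, hh] at hj ⊢
    · have := (kite_two_mem_convexHull_iff hh).1 (himg2 ▸ hi)
      rcases Set.mem_uIcc.1 this with h | h <;> nlinarith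
    · have := (kite_two_mem_convexHull_iff hh).1 (h3 ▸ himg3 ▸ hi)
      rcases Set.mem_uIcc.1 this with h | h <;> nlinarith
  · intro hxy
    have : x ∈ Set.uIcc 0 y ∨ y ∈ Set.uIcc 0 x := by
      rw [Set.mem_uIcc, Set.mem_uIcc]
      rcases mul_nonneg_iff.1 hxy with ⟨h1, h2⟩ | ⟨h1, h2⟩ <;> rcases le_total x y with h4 | h4 <;>
        tauto
    rcases this with hm | hm
    · exact ⟨2, himg2 ▸ (kite_two_mem_convexHull_iff hh).2 hm⟩
    · exact ⟨3, by rw [himg3, h3]; exact (kite_two_mem_convexHull_iff hh).2 hm⟩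

theorem isConcaveKiteCC_kite_iff {m : ℝ} (hm : 0 ≤ m) {c h : ℂ} (hh : h ≠ 0) (x y : ℝ) :
    IsConcaveKiteCC m (kite c h x y) ↔
      ((m ≠ 0 → x ≠ y) ∧ KiteEquations m x y) ∧ ¬ (x = 0 ∧ y = 0) ∧ 0 ≤ x * y := by
  unfold IsConcaveKiteCC
  rw [isKite_kite_iff hh, isConcave_kite_iff hh, ← isCentralConfiguration_standardKite_iff hm]
  unfold kite
  rw [isCentralConfiguration_affine_iff _ hh]
  simp only [pairMass, Fin.sum_univ_four]
  simp
  positivity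

/-! ### Symmetries of the force equations and reduction to the curve -/

theorem invDist_neg (x : ℝ) : invDist (-x) = invDist x := by
  simp [invDist]

theorem KiteEquations.swap {m x y : ℝ} (h : KiteEquations m x y) : KiteEquations m y x := by
  obtain ⟨l, h0, h1, h2, h3⟩ := h
  refine ⟨l, ?_, ?_, ?_, ?_⟩
  · rw [h0]; ring
  · rw [add_comm y x, h1]; ring
  · rw [add_comm y x, h3, abs_sub_comm]
  · rw [add_comm y x, h2, abs_sub_comm]

theorem KiteEquations.neg {m x y : ℝ} (h : KiteEquations m x y) : KiteEquations m (-x) (-y) := by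
  obtain ⟨l, h0, h1, h2, h3⟩ := h
  have ha : |-x - -y| = |x - y| := by rw [← abs_neg]; ring_nf
  refine ⟨l, ?_, ?_, ?_, ?_⟩ <;> simp only [invDist_neg, ha]
  · exact h0
  · linear_combination -h1
  · linear_combination -h2
  · linear_combination -h3

/-- Adding the base's vertical equation to those of bodies 3 and 4 removes the centre of mass, and
inserting the multiplier leaves two equations. -/
theorem kiteEquations_iff {m x y : ℝ} (hm : 0 < m) (hxy : x < y) :
    KiteEquations m x y ↔
      4 * m * vv.eval x y = massNum.eval x y ∧
      4 * m * uu.eval x y = -(y * bb.eval x y * (y - x) ^ 2) := by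
  have hd : 0 < y - x := sub_pos.2 hxy
  have habs : |x - y| = y - x := by rw [abs_sub_comm, abs_of_pos hd]
  have h2 : (2 + 2 * m) ≠ 0 := by positivity
  have hf : m * (x - y) / (y - x) ^ 3 = -(m / (y - x) ^ 2) := by field_simp; ring
  have hf' : m * (y - x) / (y - x) ^ 3 = m / (y - x) ^ 2 := by field_simp
  rw [eval_vv, eval_massNum, eval_uu, eval_bb, eval_aa, KiteEquations, habs, hf, hf']
  generalize invDist x = p
  generalize invDist y = q
  obtain ⟨f, hf⟩ : ∃ f, f = m / (y - x) ^ 2 := ⟨_, rfl⟩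
  obtain ⟨g, hg⟩ : ∃ g, g = m * (x + y) / (2 + 2 * m) := ⟨_, rfl⟩
  rw [← hf, ← hg]
  rw [eq_div_iff (by positivity)] at hf hg
  have hd2 : (y - x) ^ 2 ≠ 0 := by positivity
  constructor
  · rintro ⟨l, h0, h1, h3, h4⟩
    subst h0
    constructor
    · linear_combination (-4 : ℝ) * hf + 4 * (y - x) ^ 2 * (h3 + h1)
    · linear_combination (-4 : ℝ) * hf - 4 * (y - x) ^ 2 * (h4 + h1)
  · rintro ⟨h3, h4⟩
    refine ⟨_, rfl, ?_⟩
    have h1 : (1 / 4 + m * p ^ 3 + m * q ^ 3) * g = m * (x * p ^ 3 + y * q ^ 3) := by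
      -- The base equation is not lost: it is recovered from the difference of the two reduced
      -- equations.
      have h5 : (1 / 4 + m * p ^ 3 + m * q ^ 3) * (x + y) =
          2 * (1 + m) * (x * p ^ 3 + y * q ^ 3) := by
        refine mul_left_cancel₀ hd2 ?_
        linear_combination (1 / 4 : ℝ) * (h3 - h4)
      refine mul_left_cancel₀ h2 ?_
      linear_combination (1 / 4 + m * p ^ 3 + m * q ^ 3) * hg + m * h5
    refine ⟨h1, ?_, ?_⟩
    · refine mul_left_cancel₀ hd2 ?_
      linear_combination (1 / 4 : ℝ) * h3 + hf - (y - x) ^ 2 * h1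
    · refine mul_left_cancel₀ hd2 ?_
      linear_combination (-1 / 4 : ℝ) * h4 - hf - (y - x) ^ 2 * h1

/-- Since v > 0, the equation 4mv = x a d² forces x > 0 and a > 0, that is x < √3, and determines m.
Eliminating m from the other equation gives the curve; conversely, that equation is recovered by
cancelling v. -/
theorem kiteEquations_iff_onKiteCurve {m x y : ℝ} (hm : 0 < m) (hx : 0 ≤ x) (hxy : x ≤ y) :
    (x ≠ y ∧ KiteEquations m x y) ↔ OnKiteCurve x y ∧ kiteMass x = m := by
  have hv := eval_vv_pos hx hxy
  constructor
  · rintro ⟨hne, h⟩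
    have hlt := hxy.lt_of_ne hne
    obtain ⟨h1, h2⟩ := (kiteEquations_iff hm hlt).1 h
    have hd : 0 < (y - x) ^ 2 := by have := sub_pos.2 hlt; positivity
    have hxa : 0 < x * aa.eval x y := by
      refine pos_of_mul_pos_left (b := (y - x) ^ 2) ?_ hd.le
      rw [← eval_massNum, ← h1]
      positivity
    have hx0 : 0 < x := hx.lt_of_ne (by rintro rfl; simp at hxa)
    have ha : 0 < aa.eval x y := pos_of_mul_pos_right hxa hx
    have hc : OnKiteCurve x y := by
      refine ⟨hx0, Real.lt_sqrt_of_sq_lt (eval_aa_pos_iff.1 ha), hxy, ?_⟩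
      rw [eval_massNum] at h1
      rw [eval_ff]
      refine mul_left_cancel₀ (show 4 * m ≠ 0 by positivity) ?_
      linear_combination x * aa.eval x y * h2 + y * bb.eval x y * h1
    refine ⟨hc, ?_⟩
    rw [kiteMass, ← hc.eq_kiteHeight, ← h1]
    field_simp
  · rintro ⟨hc, hcm⟩
    refine ⟨hc.xlt.ne, (kiteEquations_iff hm hc.xlt).2 ?_⟩
    rw [kiteMass, ← hc.eq_kiteHeight, div_eq_iff (by positivity)] at hcm
    refine ⟨by rw [hcm]; ring, mul_left_cancel₀ hv.ne' ?_⟩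
    have h0 := hc.eq_zero
    rw [eval_massNum] at hcm
    rw [eval_ff] at h0
    linear_combination (y - x) ^ 2 * h0 - uu.eval x y * hcm

/-! ### Types correspond to parameters -/

theorem standardKite_kite_equiv (c : ℂ) {h : ℂ} (hh : h ≠ 0) (x y : ℝ) :
    configSetoid (standardKite x y) (kite c h x y) := by
  refine ⟨1, fun _ => Iff.rfl, h, c, hh, fun i => ?_⟩
  rw [kite, Equiv.Perm.one_apply, add_comm]

theorem standardKite_swap_equiv (x y : ℝ) :
    configSetoid (standardKite x y) (standardKite y x) := by
  refine ⟨Equiv.swap 2 3, fun i => ?_, 1, 0, one_ne_zero, fun i => ?_⟩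
  · fin_cases i <;> simp [Equiv.swap_apply_of_ne_of_ne]
  · rw [standardKite_eq_kite, standardKite_eq_kite, kite_swap]
    simp

/-- The rotation by π exchanges the two base points, so no reflection is needed. -/
theorem standardKite_neg_equiv (x y : ℝ) :
    configSetoid (standardKite x y) (standardKite (-x) (-y)) := by
  refine ⟨Equiv.swap 0 1, fun i => ?_, -1, 0, by norm_num, fun i => ?_⟩
  · fin_cases i <;> simp [Equiv.swap_apply_of_ne_of_ne]
  · fin_cases i <;> simp [standardKite, Equiv.swap_apply_of_ne_of_ne]

/-- The parameters of the concave kite central configurations in normal form. -/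
def kiteParameters (m : ℝ) : Set (ℝ × ℝ) :=
  {z | 0 ≤ z.1 ∧ z.1 ≤ z.2 ∧ z.2 ≠ 0 ∧ (m ≠ 0 → z.1 ≠ z.2) ∧ KiteEquations m z.1 z.2}

theorem isConcaveKiteCC_standardKite {m : ℝ} (hm : 0 ≤ m) {z : ℝ × ℝ}
    (hz : z ∈ kiteParameters m) : IsConcaveKiteCC m (standardKite z.1 z.2) := by
  obtain ⟨h0, h1, h2, h3, h4⟩ := hz
  rw [standardKite_eq_kite, isConcaveKiteCC_kite_iff hm one_ne_zero]
  exact ⟨⟨h3, h4⟩, fun h => h2 h.2, mul_nonneg h0 (h0.trans h1)⟩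

theorem IsConcaveKiteCC.exists_kiteParameters {m : ℝ} (hm : 0 ≤ m) {q : Fin 4 → ℂ}
    (hq : IsConcaveKiteCC m q) :
    ∃ z ∈ kiteParameters m, configSetoid (standardKite z.1 z.2) q := by
  obtain ⟨c, h, x, y, hh, rfl⟩ := exists_eq_kite hq.2.1.2.1 hq.2.1.2.2.1 hq.2.1.2.2.2
  obtain ⟨⟨h1, h2⟩, h3, h4⟩ := (isConcaveKiteCC_kite_iff hm hh x y).1 hq
  have hequiv := standardKite_kite_equiv c hh x y
  obtain ⟨x', y', hx', hy', h1', h2', h3', he'⟩ : ∃ x' y' : ℝ, 0 ≤ x' ∧ 0 ≤ y' ∧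
      (m ≠ 0 → x' ≠ y') ∧ KiteEquations m x' y' ∧ ¬ (x' = 0 ∧ y' = 0) ∧
      configSetoid (standardKite x' y') (kite c h x y) := by
    rcases mul_nonneg_iff.1 h4 with ⟨hx, hy⟩ | ⟨hx, hy⟩
    · exact ⟨x, y, hx, hy, h1, h2, h3, hequiv⟩
    · refine ⟨-x, -y, by linarith, by linarith, by simpa using h1, h2.neg, by simpa using h3, ?_⟩
      exact configSetoid.trans (configSetoid.symm (standardKite_neg_equiv x y)) hequiv
  rcases le_total x' y' with hle | hle
  · exact ⟨(x', y'), ⟨hx', hle, fun h0 => h3' ⟨le_antisymm (hle.trans h0.le) hx', h0⟩, h1', h2'⟩,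
      he'⟩
  · exact ⟨(y', x'), ⟨hy', hle, fun h0 => h3' ⟨h0, le_antisymm (hle.trans h0.le) hy'⟩,
      fun hm0 => (h1' hm0).symm, h2'.swap⟩,
      configSetoid.trans (standardKite_swap_equiv y' x') he'⟩

/-- A similarity preserving the pair -1, 1 fixes 0 and is ± the identity, so it preserves absolute
values, hence nonnegative heights; the ordering of the heights disposes of the swap of bodies 3 and
4. -/
theorem eq_of_standardKite_equiv {x y x' y' : ℝ} (hx : 0 ≤ x) (hxy : x ≤ y) (hx' : 0 ≤ x')
    (hxy' : x' ≤ y') (h : configSetoid (standardKite x y) (standardKite x' y')) :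
    x = x' ∧ y = y' := by
  obtain ⟨σ, hσ, w, v, hw, hq⟩ := h
  have hy := hx.trans hxy
  have hy' := hx'.trans hxy'
  have e0 := hq 0
  have e1 := hq 1
  have e2 := hq 2
  have e3 := hq 3
  have s0 := hσ 0
  have s1 := hσ 1
  have s2 := hσ 2
  have s3 := hσ 3
  have n01 : σ 0 ≠ σ 1 := fun h => by simpa using σ.injective h
  have n23 : σ 2 ≠ σ 3 := fun h => by simpa using σ.injective h
  have hbase : standardKite x' y' 0 = -1 ∧ standardKite x' y' 1 = 1 ∧
      standardKite x' y' 2 = x' * Complex.I ∧ standardKite x' y' 3 = y' * Complex.I := by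
    simp [standardKite]
  rw [hbase.1] at e0
  rw [hbase.2.1] at e1
  rw [hbase.2.2.1] at e2
  rw [hbase.2.2.2] at e3
  have hbase' : standardKite x y 0 = -1 ∧ standardKite x y 1 = 1 ∧
      standardKite x y 2 = x * Complex.I ∧ standardKite x y 3 = y * Complex.I := by
    simp [standardKite]
  obtain ⟨b0, b1, b2, b3⟩ := hbase'
  have hwv : v = 0 ∧ ‖w‖ = 1 := by
    generalize σ 0 = i at *
    generalize σ 1 = j at *
    fin_cases i <;> fin_cases j <;> simp [b0, b1] at n01 s0 s1 e0 e1
    · have hv : v = 0 := by linear_combination -(e0 + e1) / 2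
      subst hv
      exact ⟨rfl, by rw [show w = 1 by linear_combination -e1]; simp⟩
    · have hv : v = 0 := by linear_combination -(e0 + e1) / 2
      subst hv
      exact ⟨rfl, by rw [show w = -1 by linear_combination -e0]; simp⟩
  obtain ⟨rfl, hw1⟩ := hwv
  have key : ∀ s t : ℝ, 0 ≤ s → 0 ≤ t → (s : ℂ) * Complex.I = w * (t * Complex.I) + 0 → s = t := by
    intro s t hs ht he
    have := congrArg norm he
    simpa [hw1, abs_of_nonneg hs, abs_of_nonneg ht] using this
  generalize σ 2 = i at *
  generalize σ 3 = j at *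
  fin_cases i <;> fin_cases j <;> simp [b2, b3, -add_zero] at n23 s2 s3 e2 e3
  · exact ⟨(key _ _ hx' hx e2).symm, (key _ _ hy' hy e3).symm⟩
  · have h1 := key _ _ hx' hy e2
    have h2 := key _ _ hy' hx e3
    constructor <;> linarith

theorem encard_concaveKiteTypes {m : ℝ} (hm : 0 ≤ m) :
    (concaveKiteTypes m).encard = (kiteParameters m).encard := by
  have himg : concaveKiteTypes m =
      (fun z : ℝ × ℝ => Quotient.mk configSetoid (standardKite z.1 z.2)) '' kiteParameters m := by
    refine Set.Subset.antisymm ?_ ?_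
    · rintro _ ⟨q, hq, rfl⟩
      obtain ⟨z, hz, he⟩ := IsConcaveKiteCC.exists_kiteParameters hm hq
      exact ⟨z, hz, Quotient.sound he⟩
    · rintro _ ⟨z, hz, rfl⟩
      exact ⟨_, isConcaveKiteCC_standardKite hm hz, rfl⟩
  rw [himg]
  refine Set.InjOn.encard_image ?_
  rintro ⟨x, y⟩ hz ⟨x', y'⟩ hz' he
  have := eq_of_standardKite_equiv hz.1 hz.2.1 hz'.1 hz'.2.1 (Quotient.exact he)
  exact Prod.ext this.1 this.2

theorem kiteParameters_of_pos {m : ℝ} (hm : 0 < m) :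
    kiteParameters m = (fun x => (x, kiteHeight x)) '' {x | (0 < x ∧ x < √3) ∧ kiteMass x = m} := by
  refine Set.Subset.antisymm ?_ ?_
  · rintro ⟨x, y⟩ ⟨h0, h1, -, h3, h4⟩
    obtain ⟨hc, hcm⟩ := (kiteEquations_iff_onKiteCurve hm h0 h1).1 ⟨h3 hm.ne', h4⟩
    exact ⟨x, ⟨⟨hc.pos, hc.lt⟩, hcm⟩, Prod.ext rfl hc.eq_kiteHeight.symm⟩
  · rintro _ ⟨x, ⟨⟨h0, h3⟩, hxm⟩, rfl⟩
    have hc := onKiteCurve_kiteHeight h0 h3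
    have := (kiteEquations_iff_onKiteCurve hm h0.le hc.le).2 ⟨hc, hxm⟩
    exact ⟨h0.le, hc.le, hc.y_pos.ne', fun _ => this.1, this.2⟩

theorem encard_concaveKiteTypes_of_pos {m : ℝ} (hm : 0 < m) :
    (concaveKiteTypes m).encard = {x | (0 < x ∧ x < √3) ∧ kiteMass x = m}.encard := by
  rw [encard_concaveKiteTypes hm.le, kiteParameters_of_pos hm]
  exact Set.InjOn.encard_image fun x _ y _ h => congrArg Prod.fst h

/-! ### Massless bodies and conclusion -/

/-- With m = 0 the multiplier is 1/4 and each height t satisfies t (8 `invDist t`³ - 1) = 0 on its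
own. -/
theorem kiteEquations_zero_iff {x y : ℝ} :
    KiteEquations 0 x y ↔ (x = 0 ∨ x ^ 2 = 3) ∧ (y = 0 ∨ y ^ 2 = 3) := by
  have key : ∀ t : ℝ, 1 / 4 * t = 2 * t * invDist t ^ 3 ↔ t = 0 ∨ t ^ 2 = 3 := fun t => by
    have h1 : 8 * invDist t ^ 3 - 1 = 0 ↔ t ^ 2 = 3 := by
      rw [← not_iff_not, ← ne_eq, ← ne_eq, ne_iff_lt_or_gt, ne_iff_lt_or_gt]
      rw [eight_mul_invDist_cube_sub_one_neg_iff, eight_mul_invDist_cube_sub_one_pos_iff, or_comm]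
    rw [← h1, ← mul_eq_zero]
    constructor <;> intro h <;> linarith
  rw [← key, ← key]
  simp [KiteEquations]

theorem kiteParameters_zero : kiteParameters 0 = {(0, √3), (√3, √3)} := by
  have h3 : (0 : ℝ) < √3 := by positivity
  have key : ∀ t : ℝ, 0 ≤ t → t ^ 2 = 3 → t = √3 := fun t ht h => by rw [← h, Real.sqrt_sq ht]
  refine Set.Subset.antisymm ?_ ?_
  · rintro ⟨x, y⟩ ⟨h0, h1, h2, -, h4⟩
    obtain ⟨hx, hy⟩ := kiteEquations_zero_iff.1 h4
    have hy3 := key y (h0.trans h1) (hy.resolve_left h2)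
    rcases hx with hx | hx
    · exact .inl (Prod.ext hx hy3)
    · exact .inr (Prod.ext (key x h0 hx) hy3)
  · rintro _ (rfl | rfl)
    · exact ⟨le_rfl, h3.le, h3.ne', by simp, kiteEquations_zero_iff.2 (by simp)⟩
    · exact ⟨h3.le, le_rfl, h3.ne', by simp, kiteEquations_zero_iff.2 (by simp)⟩

theorem isConcaveKiteCC_zero_iff (q : Fin 4 → ℂ) :
    (IsConcaveKiteCC 0 q ∧ q 2 ∈ convexHull ℝ {q 0, q 1, q 3}) ↔
      (q 0 ≠ q 1 ∧ dist (q 0) (q 3) = dist (q 0) (q 1) ∧ dist (q 1) (q 3) = dist (q 0) (q 1) ∧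
        (q 2 = midpoint ℝ (q 0) (q 1) ∨ q 2 = q 3)) := by
  have hmid : ∀ (c h : ℂ) (x y : ℝ), midpoint ℝ (kite c h x y 0) (kite c h x y 1) = c :=
    fun c h x y => by
      rw [kite_zero, kite_one, midpoint_eq_smul_add, invOf_eq_inv, Complex.real_smul]
      push_cast
      ring
  have d01 : ∀ (c h : ℂ) (x y : ℝ), dist (kite c h x y 0) (kite c h x y 1) = ‖h‖ * 2 :=
    fun c h x y => by
      rw [kite_zero, kite_one, dist_eq_norm, show c - h - (c + h) = h * (-2) by ring, norm_mul]
      norm_num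
  have d03 : ∀ (c h : ℂ) (x y : ℝ),
      dist (kite c h x y 0) (kite c h x y 3) = ‖h‖ * √(1 + y ^ 2) := fun c h x y => by
    rw [kite_zero, kite_three, dist_eq_norm,
      show c - h - (c + h * (y * Complex.I)) = h * (-1 + (-y : ℝ) * Complex.I) by push_cast; ring,
      norm_mul, norm_eq_inv_invDist (z := -1 + (-y : ℝ) * Complex.I) (x := y) (by simp), invDist,
      inv_inv]
  have hsq : ∀ y : ℝ, √(1 + y ^ 2) = 2 ↔ y ^ 2 = 3 := fun y => by
    rw [Real.sqrt_eq_iff_eq_sq (by positivity) (by norm_num)]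
    constructor <;> intro h <;> linarith
  constructor
  · rintro ⟨hq, hmem⟩
    obtain ⟨c, h, x, y, hh, rfl⟩ := exists_eq_kite hq.2.1.2.1 hq.2.1.2.2.1 hq.2.1.2.2.2
    obtain ⟨⟨-, h2⟩, h3, -⟩ := (isConcaveKiteCC_kite_iff le_rfl hh x y).1 hq
    rw [kite_two_mem_convexHull_iff hh, Set.mem_uIcc] at hmem
    obtain ⟨hx, hy⟩ := kiteEquations_zero_iff.1 h2
    -- If y were 0, the hull condition would give x = 0, and the configuration would be collinear.
    have hy3 : y ^ 2 = 3 := by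
      refine hy.resolve_left fun hy0 => h3 ⟨?_, hy0⟩
      rcases hmem with h | h <;> linarith [h.1, h.2]
    have hd03 : dist (kite c h x y 0) (kite c h x y 3) =
        dist (kite c h x y 0) (kite c h x y 1) := by
      rw [d01, d03, (hsq y).2 hy3]
    have hbis := AffineSubspace.mem_perpBisector_iff_dist_eq.1 hq.2.1.2.2.2
    refine ⟨hq.2.1.2.1, hd03, ?_, ?_⟩
    · rw [dist_comm, ← hbis, dist_comm, hd03]
    · rw [hmid, kite_two, kite_three]
      rcases hx with hx | hx
      · left; simp [hx]
      · right
        have : x = y := by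
          rcases sq_eq_sq_iff_eq_or_eq_neg.1 (hx.trans hy3.symm) with h | h
          · exact h
          · rcases hmem with h' | h' <;> nlinarith [h'.1, h'.2]
        rw [this]
  · rintro ⟨h01, hd, hd', h2⟩
    have hb3 : q 3 ∈ AffineSubspace.perpBisector (q 0) (q 1) := by
      rw [AffineSubspace.mem_perpBisector_iff_dist_eq, dist_comm, hd, dist_comm (q 3), hd']
    have hb2 : q 2 ∈ AffineSubspace.perpBisector (q 0) (q 1) := by
      rcases h2 with h2 | h2 <;> rw [h2]
      · exact AffineSubspace.midpoint_mem_perpBisector _ _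
      · exact hb3
    obtain ⟨c, h, x, y, hh, rfl⟩ := exists_eq_kite h01 hb2 hb3
    rw [d01, d03, mul_right_inj' (norm_ne_zero_iff.2 hh), hsq] at hd
    rw [hmid, kite_two, kite_three] at h2
    have hy0 : y ≠ 0 := by rintro rfl; norm_num at hd
    have hx : x = 0 ∨ x = y := by
      rcases h2 with h2 | h2
      · left; simpa [hh] using h2
      · right; simpa [hh] using h2
    rw [isConcaveKiteCC_kite_iff le_rfl hh, kite_two_mem_convexHull_iff hh, kiteEquations_zero_iff]
    refine ⟨⟨⟨by simp, ?_, .inr hd⟩, fun h => hy0 h.2, ?_⟩, ?_⟩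
    · rcases hx with rfl | rfl
      · exact .inl rfl
      · exact .inr hd
    · rcases hx with rfl | rfl
      · simp
      · exact mul_self_nonneg x
    · rcases hx with rfl | rfl <;> simp

theorem theorem2 :
    (∃ m₀ : ℝ, |m₀ - 1.002713329037083| ≤ 5 * (10 : ℝ) ^ (-16 : ℤ) ∧
      (∀ m : ℝ, 0 < m → m < m₀ → (concaveKiteTypes m).encard = 2) ∧
      (concaveKiteTypes m₀).encard = 1 ∧
      (∀ m : ℝ, m₀ < m → concaveKiteTypes m = ∅)) ∧
    (concaveKiteTypes 0).encard = 2 ∧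
    (∀ q : Fin 4 → ℂ,
      (IsConcaveKiteCC 0 q ∧ q 2 ∈ convexHull ℝ {q 0, q 1, q 3}) ↔
      (q 0 ≠ q 1 ∧ dist (q 0) (q 3) = dist (q 0) (q 1) ∧ dist (q 1) (q 3) = dist (q 0) (q 1) ∧
        (q 2 = midpoint ℝ (q 0) (q 1) ∨ q 2 = q 3))) := by
  obtain ⟨hlo, hhi⟩ := kiteMass_criticalParameter_bounds
  have hpos : 0 < kiteMass criticalParameter := lt_trans (by norm_num) hlo
  refine ⟨⟨kiteMass criticalParameter, ?_, fun m h0 h1 => ?_, ?_, fun m h1 => ?_⟩, ?_,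
    isConcaveKiteCC_zero_iff⟩
  · rw [abs_le]
    norm_num at hlo hhi ⊢
    constructor <;> linarith
  · rw [encard_concaveKiteTypes_of_pos h0, encard_kiteMass_fiber_eq_two h0 h1]
  · rw [encard_concaveKiteTypes_of_pos hpos, Set.encard_eq_one]
    refine ⟨criticalParameter, Set.Subset.antisymm ?_ ?_⟩
    · rintro x ⟨⟨h0, h3⟩, hx⟩
      by_contra hne
      exact (kiteMass_lt_max h0 h3 hne).ne hx
    · rintro _ rfl
      exact ⟨⟨criticalParameter_pos, criticalParameter_lt⟩, rfl⟩
  · rw [← Set.encard_eq_zero, encard_concaveKiteTypes_of_pos (hpos.trans h1), Set.encard_eq_zero,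
      Set.eq_empty_iff_forall_notMem]
    rintro x ⟨⟨h0, h3⟩, hx⟩
    rcases eq_or_ne x criticalParameter with rfl | hne
    · exact h1.ne hx
    · exact (h1.trans_eq hx.symm).not_gt (kiteMass_lt_max h0 h3 hne)
  · rw [encard_concaveKiteTypes le_rfl, kiteParameters_zero]
    refine Set.encard_pair fun h => ?_
    exact (Real.sqrt_pos.2 (by norm_num : (0 : ℝ) < 3)).ne (congrArg Prod.fst h)
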